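/- **Setting.** Let $\phi(a)=\max(a,0)$. A sparse-input hierarchical network with $L'\ge 2$ layers and inputs $x\in[-1,1]^d$ has input scalings $\beta\in\mathbb R^d$, hidden layers of arbitrary finite widths, weight matrices $W_l$ and biases $b_l$, skip-connection weights $W'_l$ and biases $b'_l$, and factors $\alpha_1,\dots,\alpha_{L'-1}\in\mathbb R$, not all zero. Its output is $$f_\theta(x)=\sum_{l=1}^{L'-1} a_l\,(z_lW'_l+b'_l),\qquad a_l=\frac{|\alpha_l|}{\sum_{k=1}^{L'-1}|\alpha_k|},\qquad z_{1,i}=\beta_ix_i,\quad z_{l}=\phi(z_{l-1}W_{l-1}+b_{l-1})\ \ (2\le l\le L'-1).$$ Its total variation norm is the sum, over all paths from an input variable or from a constant unit (biases being the weights of the edges that leave constant units) to the output, of the products of the absolute values of the weights along the path, where $\beta_i$ is the weight of the edge from $x_i$ to $z_{1,i}$ and $a_l$ that of the edge from the $l$-th skip-connection node to the output. Let $\Theta_{L,B_0,B_1}$ be the set of all such parameters $\theta$ with at most $L$ layers, $\sup_{x\in[-1,1]^d}|f_\theta(x)|\le B_0$ and total variation norm at most $B_1$. The support $s(f)\subseteq\{1,\dots,d\}$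 of $f:[-1,1]^d\to\mathbb R$ is the smallest set such that $f(x)=f(x')$ whenever $x_i=x'_i$ for all $i\in s(f)$. Let $P$ be the distribution of $(X,Y)\in[-1,1]^d\times\mathbb R$ with $Y=\mu_P(X)+\epsilon$, where $\mu_P=f_{\theta^*}$ for some $\theta^*\in\Theta_{L,B_0,B_1}$, and $\epsilon\sim N(0,\sigma^2)$, $\sigma>0$, is independent of $X$. Write $s^*_P=s(\mu_P)$. Let $\mathcal F$ be any class of functions $f:[-1,1]^d\to\mathbb R$ with $\mathbb E_P f(X)^2<\infty$ that contains every $f_\theta$, $\theta\in\Theta_{L,B_0,B_1}$ (for instance exactly these networks). For $1\le m\le d$ let $$\gamma(m;P)=\min_{\tilde s\subseteq\{1,\dots,d\}:\,|s_P^*\setminus\tilde s|=m}\ \inf_{f\in\mathcal F:\,s(f)\subseteq\tilde s}\mathbb E_P\{(f(X)-Y)^2-(\mu_P(X)-Y)^2\}$$ be the minimal excess risk from omitting $m$ variables of the true support ($+\infty$ if $|s_P^*|<m$). **Theorem.** Let $(X_i,Y_i)$, $i=1,\dots,n$, be independent observations from $P$, and let $$\hat\theta_n\in\operatorname*{arg\,min}_{\theta\in\Theta_{L,B_0,B_1}}\frac1n\sum_{i=1}^n(f_\theta(X_i)-Y_i)^2$$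 be a global empirical risk minimizer. Then for every $m=1,\dots,d$ and every $\delta\ge0$, $$\Pr\left(|s_P^*\setminus s(f_{\hat\theta_n})|\ge m\right)\le \mathbf 1\left\{B_1(4B_0+\sigma)L\sqrt{\frac{2(L\log2+\log(2d))}{n}}+2\delta\ge\gamma(m;P)\right\}+\exp\left(-\frac{n\delta^2}{2B_0^4}\right)+2\exp\left(-\frac{n\delta^2}{8B_0^2\sigma^2}\right).$$ -/

import Mathlib

open MeasureTheory ProbabilityTheory

noncomputable section

/-- The input space `[-1,1]^d`. -/
abbrev Cube (d : ℕ) : Type := Fin d → Set.Icc (-1 : ℝ) 1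

/-- The support of a function on the cube: the coordinates on which it really depends.
By the two lemmas below it is the least set of coordinates that determines `f`; in particular it is
the unique determining set of smallest cardinality. -/
def coordSupport {d : ℕ} (f : Cube d → ℝ) : Finset (Fin d) :=
  open Classical in
  Finset.univ.filter fun i => ∃ x y : Cube d, (∀ j, j ≠ i → x j = y j) ∧ f x ≠ f y

theorem coordSupport_subset {d : ℕ} {f : Cube d → ℝ} {s : Finset (Fin d)}
    (h : DependsOn f (s : Set (Fin d))) : coordSupport f ⊆ s := by
  classical
  intro i hi
  simp only [coordSupport, Finset.mem_filter, Finset.mem_univ, true_and] at hi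
  obtain ⟨x, y, hxy, hne⟩ := hi
  by_contra his
  exact hne (h fun j hj => hxy j fun hji => his (by simpa [hji] using hj))

theorem dependsOn_coordSupport {d : ℕ} (f : Cube d → ℝ) :
    DependsOn f (coordSupport f : Set (Fin d)) := by
  classical
  intro x y hxy
  have key : ∀ t : Finset (Fin d), f (fun i => if i ∈ t then y i else x i) = f x := by
    intro t
    induction t using Finset.induction_on with
    | empty => simp
    | insert a t ha ih =>
      rw [← ih]
      by_cases has : a ∈ coordSupport f
      · congr 1
        funext i
        by_cases hia : i = a
        · subst hia
          simp [ha, hxy i has]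
        · simp [hia]
      · by_contra hne
        apply has
        simp only [coordSupport, Finset.mem_filter, Finset.mem_univ, true_and]
        exact ⟨_, _, fun j hj => by simp [hj], hne⟩
  simpa using (key Finset.univ).symm

/-- Number of nodes of layer `l`, where layer `0` is the (filtered) input layer with `d` nodes and
layer `l + 1` is the hidden layer number `l + 1`, with `width l` nodes. -/
def layerNodes (d : ℕ) (width : ℕ → ℕ) : ℕ → ℕ
  | 0 => d
  | l + 1 => width l

/-- Parameters of a sparse-input hierarchical network with inputs in `ℝ^d` and one real output.
Layers are numbered from `0` (filtered input) to `numHidden` (last hidden layer), followed by the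
output layer. Entries that belong to layers after the last hidden one are not used. -/
structure SierNet (d : ℕ) where
  /-- number of hidden layers -/
  numHidden : ℕ
  /-- widths of the hidden layers -/
  width : ℕ → ℕ
  /-- input scaling factors -/
  β : Fin d → ℝ
  /-- weights from layer `l` to layer `l + 1` -/
  W : ∀ l : ℕ, Matrix (Fin (layerNodes d width l)) (Fin (layerNodes d width (l + 1))) ℝ
  /-- biases of layer `l + 1` -/
  b : ∀ l : ℕ, Fin (layerNodes d width (l + 1)) → ℝ
  /-- weights of the skip-connection node of layer `l` -/
  wSkip : ∀ l : ℕ, Fin (layerNodes d width l) → ℝ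
  /-- bias of the skip-connection node of layer `l` -/
  bSkip : ℕ → ℝ
  /-- skip-connection factors, not all equal to zero -/
  α : ℕ → ℝ
  sum_abs_α_pos : 0 < ∑ l ∈ Finset.range (numHidden + 1), |α l|

namespace SierNet

variable {d : ℕ}

/-- Total number of layers, the input and the output layer included. -/
def numLayers (θ : SierNet d) : ℕ := θ.numHidden + 2

/-- Normalized skip-connection weight of layer `l`. -/
def skipWeight (θ : SierNet d) (l : ℕ) : ℝ :=
  |θ.α l| / ∑ k ∈ Finset.range (θ.numHidden + 1), |θ.α k|

/-- Node values: the scaled inputs in layer `0`, ReLU units in the hidden layers. -/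
def nodeVal (θ : SierNet d) (x : Cube d) : ∀ l : ℕ, Fin (layerNodes d θ.width l) → ℝ
  | 0 => fun i : Fin d => θ.β i * (x i : ℝ)
  | l + 1 => fun j => max (∑ i, θ.nodeVal x l i * θ.W l i j + θ.b l j) 0

/-- Value of the skip-connection node of layer `l`. -/
def skipVal (θ : SierNet d) (x : Cube d) (l : ℕ) : ℝ :=
  ∑ i, θ.nodeVal x l i * θ.wSkip l i + θ.bSkip l

/-- The function computed by the network (regression: the output map is the identity). -/
def eval (θ : SierNet d) (x : Cube d) : ℝ :=
  ∑ l ∈ Finset.range (θ.numHidden + 1), θ.skipWeight l * θ.skipVal x l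

/-- Sum, over all paths that lead from an input variable or from a constant unit to a node of
layer `l`, of the product of the absolute weights along the path. A bias is the weight of an edge
that starts at a constant unit. -/
def pathWeight (θ : SierNet d) : ∀ l : ℕ, Fin (layerNodes d θ.width l) → ℝ
  | 0 => fun i : Fin d => |θ.β i|
  | l + 1 => fun j => ∑ i, θ.pathWeight l i * |θ.W l i j| + |θ.b l j|

/-- Total (path) variation norm of the network: the sum, over all paths from an input variable or
a constant unit to the output, of the product of the absolute weights along the path. -/
def totalVariation (θ : SierNet d) : ℝ :=
  ∑ l ∈ Finset.range (θ.numHidden + 1),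
    θ.skipWeight l * (∑ i, θ.pathWeight l i * |θ.wSkip l i| + |θ.bSkip l|)

end SierNet

/-- All network parameters with at most `L` layers, supremum norm on the cube at most `B₀` and total
variation norm at most `B₁`. -/
def sierParams (d L : ℕ) (B₀ B₁ : ℝ) : Set (SierNet d) :=
  {θ | θ.numLayers ≤ L ∧ (∀ x, |θ.eval x| ≤ B₀) ∧ θ.totalVariation ≤ B₁}

/-- Empirical risk of `f` under the squared error loss. -/
def empiricalRisk {d n : ℕ} (z : Fin n → Cube d × ℝ) (f : Cube d → ℝ) : ℝ :=
  (1 / n : ℝ) * ∑ i, (f (z i).1 - (z i).2) ^ 2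

/-- Excess risk of `f` over `μ` under the squared error loss and the data distribution `P`. -/
def excessRisk {d : ℕ} (P : Measure (Cube d × ℝ)) (μ f : Cube d → ℝ) : ℝ :=
  ∫ z, ((f z.1 - z.2) ^ 2 - (μ z.1 - z.2) ^ 2) ∂P

/-- Minimal excess risk over the functions of the class `F` whose support omits `m` variables of the
support of `μ`. It is `⊤` if the support of `μ` has fewer than `m` elements. -/
def predictiveValue {d : ℕ} (F : Set (Cube d → ℝ)) (P : Measure (Cube d × ℝ)) (μ : Cube d → ℝ)
    (m : ℕ) : EReal :=
  ⨅ (s : Finset (Fin d)) (_ : (coordSupport μ \ s).card = m),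
    ⨅ (f : Cube d → ℝ) (_ : f ∈ F ∧ coordSupport f ⊆ s), ((excessRisk P μ f : ℝ) : EReal)

end

/-! If the minimizer omits at least `m` variables of the true support, its excess risk is at least
the predictive value. Since the noise is centred and independent of the design, this excess risk is
the squared L² distance to the regression function (`excessRisk_eq_integral_sq`). So when the
indicator vanishes, it suffices to bound the probability that least squares selects a network at
squared distance above some `κ > rad + 2δ`.

The functions computed by the class form a convex set: two networks can be run side by side, and the
path norm of the mixture is at most the mixture of the path norms
(`SierNet.exists_eval_eq_convexCombination`). Hence `g = f - μ` for the minimizer `f` satisfies `∑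
g² ≤ ∑ g ε`, without the usual factor 2 (`sum_sq_le_of_isMin_empiricalRisk`), and differences may be
shrunk towards zero. Given the design, let `A` be the largest value of `n E g² - ∑ g²`; every
distant `g` has `∑ g² ≥ Q = nκ - A`. Shrink each `g` to squared norm exactly `Q`: the maximum of a
Gaussian process with variances at most `Q σ²` must then exceed `Q`. Its sub-Gaussian tail
(`mgf_maxLinear_le`) gives the bound `exp(-λ(Q - 2M))` whenever `8λσ² ≤ 1`, where `M` bounds the
Gaussian complexity. The exponent is linear in `A`, so the design is integrated out with the
bounded-differences bound for `E exp(λA)`, the mean of `A` being controlled by symmetrization. Noise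
and design thus share one exponent, and the choice of `λ` produces one or the other exponential of
the theorem.

Both complexities reduce to a weighted Rademacher complexity (`sum_signs_iSup_abs_eval_le`). Divided
by its path weight, every preactivation is an absolutely convex combination of normalized nodes of
the layer below and the constant unit; rectification costs a factor 2 in exponential moments. The `d
+ 1` functions of the input layer thus become at most `2^L * 2d` under the logarithm, whatever the
widths and the number of networks.

Suprema are taken over finite families, where they are attained and measurable; separability of the
continuous functions extends the bound to the whole class (`exists_dense_network_seq`). -/

/-! ### Random signs: contraction and exponential moments. -/

/-- The real sign encoded by a Boolean. -/
def boolSign (b : Bool) : ℝ := if b then 1 else -1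

@[simp] theorem boolSign_true : boolSign true = 1 := rfl

@[simp] theorem boolSign_false : boolSign false = -1 := rfl

@[simp] theorem boolSign_not (b : Bool) : boolSign (!b) = -boolSign b := by
  cases b <;> simp [boolSign]

theorem abs_boolSign (b : Bool) : |boolSign b| = 1 := by
  cases b <;> simp [boolSign]

theorem sum_signs_succ {n : ℕ} (F : (Fin (n + 1) → Bool) → ℝ) :
    ∑ r, F r = ∑ r : Fin n → Bool, (F (Fin.cons true r) + F (Fin.cons false r)) := by
  rw [← (Fin.consEquiv fun _ : Fin (n + 1) => Bool).sum_comp, Fintype.sum_prod_type]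
  simp [Fin.consEquiv, Finset.sum_add_distrib]

/-- The comparison of two functions over one random sign: what an application of a contraction
to one coordinate needs. -/
def SignDominated {ι : Type*} (Ψ : ℝ → ℝ) (p q : ι → ℝ) : Prop :=
  ∀ c : ι → ℝ, Ψ (⨆ i, (c i + p i)) + Ψ (⨆ i, (c i - p i)) ≤
    Ψ (⨆ i, (c i + q i)) + Ψ (⨆ i, (c i - q i))

/-- The coordinates are exchanged one at a time. The offset `c` is arbitrary because it has to
absorb the coordinates that are not being exchanged. -/
theorem sum_signs_contraction {ι : Type*} {Ψ : ℝ → ℝ} {n : ℕ} (p q : ι → Fin n → ℝ)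
    (h : ∀ k, SignDominated Ψ (fun i => p i k) (fun i => q i k)) (c : ι → ℝ) :
    ∑ r : Fin n → Bool, Ψ (⨆ i, (c i + ∑ k, boolSign (r k) * p i k)) ≤
      ∑ r : Fin n → Bool, Ψ (⨆ i, (c i + ∑ k, boolSign (r k) * q i k)) := by
  induction n generalizing c with
  | zero => simp
  | succ n ih =>
    have e1 : ∀ (b : Bool), ∑ r : Fin n → Bool,
        Ψ (⨆ i, (c i + ∑ k, boolSign ((Fin.cons b r : Fin (n + 1) → Bool) k) * p i k)) ≤
        ∑ r : Fin n → Bool,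
          Ψ (⨆ i, ((c i + ∑ k, boolSign (r k) * q i k.succ) + boolSign b * p i 0)) := by
      intro b
      have := ih (fun i k => p i k.succ) (fun i k => q i k.succ) (fun k => h k.succ)
        (fun i => c i + boolSign b * p i 0)
      refine le_trans (le_of_eq ?_) (this.trans (le_of_eq ?_))
      · refine Finset.sum_congr rfl fun r _ => ?_
        congr 1
        refine iSup_congr fun i => ?_
        rw [Fin.sum_univ_succ]
        simp [add_assoc]
      · refine Finset.sum_congr rfl fun r _ => ?_
        congr 1
        refine iSup_congr fun i => ?_
        ring
    rw [sum_signs_succ, sum_signs_succ, Finset.sum_add_distrib]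
    refine (add_le_add (e1 true) (e1 false)).trans ?_
    rw [← Finset.sum_add_distrib]
    refine Finset.sum_le_sum fun r _ => ?_
    have := h 0 (fun i => c i + ∑ k, boolSign (r k) * q i k.succ)
    refine le_trans (le_of_eq ?_) (this.trans (le_of_eq ?_))
    · simp [sub_eq_add_neg]
    · congr 2 <;> refine iSup_congr fun i => ?_ <;> rw [Fin.sum_univ_succ] <;> simp <;> ring

/-- Over a finite index set both left suprema are attained, so only two maximizers matter; of the
right suprema one needs only that they dominate at these two indices. -/
theorem signDominated_of_forall {ι : Type*} [Finite ι] [Nonempty ι] {Ψ : ℝ → ℝ} {p q : ι → ℝ}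
    (h : ∀ (c : ι → ℝ) (s t : ι) (U V : ℝ), c s + q s ≤ U → c t + q t ≤ U → c s - q s ≤ V →
      c t - q t ≤ V → Ψ (c s + p s) + Ψ (c t - p t) ≤ Ψ U + Ψ V) :
    SignDominated Ψ p q := by
  intro c
  obtain ⟨s, hs⟩ := exists_eq_ciSup_of_finite (f := fun i => c i + p i)
  obtain ⟨t, ht⟩ := exists_eq_ciSup_of_finite (f := fun i => c i - p i)
  rw [← hs, ← ht]
  exact h c s t _ _ (le_ciSup (Finite.bddAbove_range fun i => c i + q i) s)
    (le_ciSup (Finite.bddAbove_range fun i => c i + q i) t)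
    (le_ciSup (Finite.bddAbove_range fun i => c i - q i) s)
    (le_ciSup (Finite.bddAbove_range fun i => c i - q i) t)

theorem SignDominated.neg {ι : Type*} {Ψ : ℝ → ℝ} {p q : ι → ℝ} (h : SignDominated Ψ p q) :
    SignDominated Ψ (fun i => -p i) (fun i => -q i) := by
  intro c
  have := h c
  simp only [sub_neg_eq_add, ← sub_eq_add_neg]
  linarith

/-- Contraction by a Lipschitz function, for expectations. -/
theorem signDominated_id {ι : Type*} [Finite ι] [Nonempty ι] {p q : ι → ℝ}
    (h : ∀ i j, |p i - p j| ≤ |q i - q j|) : SignDominated (fun y => y) p q := by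
  refine signDominated_of_forall fun c s t U V h1 h2 h3 h4 => ?_
  have := (abs_le.1 (le_refl |p s - p t|)).2
  have h5 := h s t
  rcases abs_cases (q s - q t) with h6 | h6 <;> linarith

theorem two_exp_le_exp_add_exp_sub (x y : ℝ) :
    2 * Real.exp x ≤ Real.exp (x + y) + Real.exp (x - y) := by
  have h := Real.one_le_cosh y
  rw [Real.cosh_eq] at h
  rw [sub_eq_add_neg, Real.exp_add, Real.exp_add]
  nlinarith [Real.exp_pos x]

/-- Contraction by the positive part, for exponential moments. -/
theorem signDominated_exp_posPart {ι : Type*} [Finite ι] [Nonempty ι] {lam : ℝ} (hl : 0 ≤ lam)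
    (q : ι → ℝ) : SignDominated (fun y => Real.exp (lam * y)) (fun i => max (q i) 0) q := by
  refine signDominated_of_forall fun c s t U V h1 h2 h3 h4 => ?_
  have e : ∀ {x y : ℝ}, x ≤ y → Real.exp (lam * x) ≤ Real.exp (lam * y) := fun h =>
    Real.exp_le_exp.2 (mul_le_mul_of_nonneg_left h hl)
  -- Convexity of the exponential: `c i` is the midpoint of `c i + q i` and `c i - q i`.
  have k : ∀ i, c i + q i ≤ U → c i - q i ≤ V →
      2 * Real.exp (lam * c i) ≤ Real.exp (lam * U) + Real.exp (lam * V) := by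
    intro i hU hV
    have := two_exp_le_exp_add_exp_sub (lam * c i) (lam * q i)
    rw [← mul_add, ← mul_sub] at this
    linarith [e hU, e hV]
  rcases le_total 0 (q s) with hs | hs
  · have : c t - max (q t) 0 ≤ c t - q t := by linarith [le_max_left (q t) 0]
    simp only [max_eq_left hs]
    linarith [e h1, e (this.trans h4)]
  · rcases le_total 0 (q t) with ht | ht
    · simp only [max_eq_left ht, max_eq_right hs, add_zero]
      -- The terms are now `c s` and `c t - q t`, and the latter is at most `c t`. Both are bounded
      -- by `c s` or both by `c t`, and `k` at that single index suffices.
      rcases le_total (c t - q t) (c s) with hc | hc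
      · linarith [k s h1 h3, e hc]
      · have : c t - q t ≤ c t := by linarith
        linarith [k t h2 h4, e hc, e this]
    · simp only [max_eq_right ht, max_eq_right hs, add_zero, sub_zero]
      linarith [k t h2 h4, k s h1 h3]

/-- Contraction by the weighted positive part, for exponential moments. -/
theorem signDominated_exp_mul_posPart {ι : Type*} [Finite ι] [Nonempty ι] {lam : ℝ}
    (hl : 0 ≤ lam) (a : ℝ) (q : ι → ℝ) :
    SignDominated (fun y => Real.exp (lam * y)) (fun i => a * max (q i) 0) (fun i => a * q i) := by
  rcases le_total 0 a with ha | ha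
  · have := signDominated_exp_posPart hl fun i => a * q i
    convert this using 2 with i
    rw [mul_max_of_nonneg _ _ ha, mul_zero]
  · have := (signDominated_exp_posPart hl fun i => -a * q i).neg
    convert this using 2 with i
    · rw [← mul_zero (-a), ← mul_max_of_nonneg _ _ (neg_nonneg.2 ha), mul_zero]
      ring
    · ring

/-- Independence factorizes the sum, and each factor is controlled by `cosh u ≤ exp (u² / 2)`. -/
theorem sum_signs_exp_le {n : ℕ} (u : Fin n → ℝ) :
    ∑ r : Fin n → Bool, Real.exp (∑ k, boolSign (r k) * u k) ≤
      2 ^ n * Real.exp ((∑ k, u k ^ 2) / 2) := by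
  have h : ∑ r : Fin n → Bool, Real.exp (∑ k, boolSign (r k) * u k) =
      ∏ k, ∑ b : Bool, Real.exp (boolSign b * u k) := by
    rw [Fintype.prod_sum]
    simp [Real.exp_sum]
  rw [h]
  have h2 : ∀ k, ∑ b : Bool, Real.exp (boolSign b * u k) ≤ 2 * Real.exp (u k ^ 2 / 2) := by
    intro k
    have := Real.cosh_le_exp_half_sq (u k)
    rw [Real.cosh_eq] at this
    simp
    linarith
  refine (Finset.prod_le_prod (fun k _ => Finset.sum_nonneg fun _ _ => (Real.exp_pos _).le)
    fun k _ => h2 k).trans (le_of_eq ?_)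
  rw [Finset.prod_mul_distrib, ← Real.exp_sum, Finset.sum_div]
  simp

theorem sum_signs_neg {n : ℕ} (F : (Fin n → ℝ) → ℝ) :
    ∑ r : Fin n → Bool, F (fun k => -boolSign (r k)) =
      ∑ r : Fin n → Bool, F (fun k => boolSign (r k)) := by
  rw [← (Equiv.piCongrRight fun _ : Fin n => Equiv.boolNot).sum_comp
    fun r => F (fun k => boolSign (r k))]
  refine Finset.sum_congr rfl fun r _ => ?_
  congr 1
  funext k
  simp

theorem exp_mul_abs_le (lam x : ℝ) :
    Real.exp (lam * |x|) ≤ Real.exp (lam * x) + Real.exp (lam * -x) := by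
  rcases abs_cases x with h | h <;> rw [h.1] <;>
    linarith [Real.exp_pos (lam * x), Real.exp_pos (lam * -x)]

/-- The exponential moment of the largest of finitely many absolute weighted sign sums. -/
theorem sum_signs_exp_iSup_abs_le {ι : Type*} [Fintype ι] [Nonempty ι] {n : ℕ}
    (v : ι → Fin n → ℝ) (a : Fin n → ℝ) (hv : ∀ i k, |v i k| ≤ 1) {lam : ℝ} :
    ∑ r : Fin n → Bool, Real.exp (lam * ⨆ i, |∑ k, boolSign (r k) * (a k * v i k)|) ≤
      2 ^ n * (2 * Fintype.card ι * Real.exp (lam ^ 2 * (∑ k, a k ^ 2) / 2)) := by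
  have h1 : ∀ (e : ℝ) (_ : e ^ 2 = 1) (i : ι), ∑ r : Fin n → Bool,
      Real.exp (lam * (e * ∑ k, boolSign (r k) * (a k * v i k))) ≤
      2 ^ n * Real.exp (lam ^ 2 * (∑ k, a k ^ 2) / 2) := by
    intro e he i
    have := sum_signs_exp_le fun k => lam * e * (a k * v i k)
    refine le_trans (le_of_eq ?_) (this.trans ?_)
    · refine Finset.sum_congr rfl fun r _ => ?_
      rw [Finset.mul_sum, Finset.mul_sum]
      congr 1
      exact Finset.sum_congr rfl fun k _ => by ring
    · gcongr
      rw [Finset.mul_sum]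
      refine Finset.sum_le_sum fun k _ => ?_
      have h2 : v i k ^ 2 ≤ 1 := (sq_le_one_iff_abs_le_one _).2 (hv i k)
      calc (lam * e * (a k * v i k)) ^ 2 = lam ^ 2 * a k ^ 2 * v i k ^ 2 * e ^ 2 := by ring
        _ ≤ lam ^ 2 * a k ^ 2 := by
          rw [he, mul_one]
          exact mul_le_of_le_one_right (by positivity) h2
  calc ∑ r : Fin n → Bool, Real.exp (lam * ⨆ i, |∑ k, boolSign (r k) * (a k * v i k)|)
      ≤ ∑ r : Fin n → Bool, ∑ i,
        (Real.exp (lam * (1 * ∑ k, boolSign (r k) * (a k * v i k))) +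
          Real.exp (lam * (-1 * ∑ k, boolSign (r k) * (a k * v i k)))) := by
        refine Finset.sum_le_sum fun r _ => ?_
        obtain ⟨i, hi⟩ := exists_eq_ciSup_of_finite
          (f := fun i => |∑ k, boolSign (r k) * (a k * v i k)|)
        rw [← hi]
        refine (exp_mul_abs_le _ _).trans ?_
        simp only [one_mul, neg_one_mul]
        exact Finset.single_le_sum (f := fun i =>
          Real.exp (lam * (∑ k, boolSign (r k) * (a k * v i k))) +
          Real.exp (lam * -∑ k, boolSign (r k) * (a k * v i k)))
          (fun _ _ => by positivity) (Finset.mem_univ i)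
    _ = ∑ i, (∑ r : Fin n → Bool,
          Real.exp (lam * (1 * ∑ k, boolSign (r k) * (a k * v i k))) +
        ∑ r : Fin n → Bool, Real.exp (lam * (-1 * ∑ k, boolSign (r k) * (a k * v i k)))) := by
        rw [Finset.sum_comm]
        simp only [Finset.sum_add_distrib]
    _ ≤ ∑ _i : ι, (2 ^ n * Real.exp (lam ^ 2 * (∑ k, a k ^ 2) / 2) +
          2 ^ n * Real.exp (lam ^ 2 * (∑ k, a k ^ 2) / 2)) :=
        Finset.sum_le_sum fun i _ => add_le_add (h1 1 (by norm_num) i) (h1 (-1) (by norm_num) i)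
    _ = _ := by simp; ring

/-- The exponential moment of the largest absolute sign sum over rectified vectors. -/
theorem sum_signs_exp_iSup_abs_posPart_le {ι : Type*} [Finite ι] [Nonempty ι] {n : ℕ}
    (u : ι → Fin n → ℝ) (a : Fin n → ℝ) {lam : ℝ} (hl : 0 ≤ lam) :
    ∑ r : Fin n → Bool, Real.exp (lam * ⨆ i, |∑ k, boolSign (r k) * (a k * max (u i k) 0)|) ≤
      2 * ∑ r : Fin n → Bool, Real.exp (lam * ⨆ i, |∑ k, boolSign (r k) * (a k * u i k)|) := by
  have hc := sum_signs_contraction (Ψ := fun y => Real.exp (lam * y))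
    (fun i k => a k * max (u i k) 0) (fun i k => a k * u i k)
    (fun k => signDominated_exp_mul_posPart hl (a k) fun i => u i k) 0
  simp only [Pi.zero_apply, zero_add] at hc
  -- Contraction needs one-sided suprema. The absolute value splits into two of them, which have the
  -- same sum over all signs; this is the origin of the factor 2.
  have h1 : ∀ r : Fin n → Bool,
      Real.exp (lam * ⨆ i, |∑ k, boolSign (r k) * (a k * max (u i k) 0)|) ≤
      Real.exp (lam * ⨆ i, ∑ k, boolSign (r k) * (a k * max (u i k) 0)) +
      Real.exp (lam * ⨆ i, ∑ k, -boolSign (r k) * (a k * max (u i k) 0)) := by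
    intro r
    obtain ⟨i, hi⟩ := exists_eq_ciSup_of_finite
      (f := fun i => |∑ k, boolSign (r k) * (a k * max (u i k) 0)|)
    rw [← hi]
    refine (exp_mul_abs_le _ _).trans (add_le_add ?_ ?_)
    · exact Real.exp_le_exp.2 (mul_le_mul_of_nonneg_left (le_ciSup (Finite.bddAbove_range
        fun i => ∑ k, boolSign (r k) * (a k * max (u i k) 0)) i) hl)
    · rw [← Finset.sum_neg_distrib]
      simp only [← neg_mul]
      exact Real.exp_le_exp.2 (mul_le_mul_of_nonneg_left (le_ciSup (Finite.bddAbove_range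
        fun i => ∑ k, -boolSign (r k) * (a k * max (u i k) 0)) i) hl)
  have h2 := sum_signs_neg (n := n) fun s =>
    Real.exp (lam * ⨆ i, ∑ k, s k * (a k * max (u i k) 0))
  calc _ ≤ _ := Finset.sum_le_sum fun r _ => h1 r
    _ = 2 * ∑ r : Fin n → Bool,
          Real.exp (lam * ⨆ i, ∑ k, boolSign (r k) * (a k * max (u i k) 0)) := by
        rw [Finset.sum_add_distrib, h2]; ring
    _ ≤ 2 * ∑ r : Fin n → Bool, Real.exp (lam * ⨆ i, ∑ k, boolSign (r k) * (a k * u i k)) := by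
        gcongr
    _ ≤ _ := by
        gcongr with r
        · exact Finite.bddAbove_range _
        · exact le_abs_self _

/-! ### Path weights as bounds for node values. -/

namespace SierNet

variable {d : ℕ}

theorem skipWeight_nonneg (θ : SierNet d) (l : ℕ) : 0 ≤ θ.skipWeight l :=
  div_nonneg (abs_nonneg _) (Finset.sum_nonneg fun _ _ => abs_nonneg _)

theorem pathWeight_nonneg (θ : SierNet d) : ∀ l j, 0 ≤ θ.pathWeight l j
  | 0, _ => abs_nonneg _
  | l + 1, _ => add_nonneg (Finset.sum_nonneg fun i _ =>
      mul_nonneg (pathWeight_nonneg θ l i) (abs_nonneg _)) (abs_nonneg _)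

theorem totalVariation_nonneg (θ : SierNet d) : 0 ≤ θ.totalVariation :=
  Finset.sum_nonneg fun l _ => mul_nonneg (θ.skipWeight_nonneg l)
    (add_nonneg (Finset.sum_nonneg fun i _ => mul_nonneg (θ.pathWeight_nonneg l i) (abs_nonneg _))
      (abs_nonneg _))

theorem abs_cube_le_one (x : Cube d) (i : Fin d) : |(x i : ℝ)| ≤ 1 := abs_le.2 (x i).2

theorem abs_nodeVal_le (θ : SierNet d) (x : Cube d) :
    ∀ l j, |θ.nodeVal x l j| ≤ θ.pathWeight l j
  | 0, j => by
    have : |θ.β j * (x j : ℝ)| ≤ |θ.β j| := by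
      rw [abs_mul]
      exact mul_le_of_le_one_right (abs_nonneg _) (abs_cube_le_one x j)
    exact this
  | l + 1, j => by
    simp only [nodeVal, pathWeight]
    have h : |∑ i, θ.nodeVal x l i * θ.W l i j + θ.b l j| ≤
        ∑ i, θ.pathWeight l i * |θ.W l i j| + |θ.b l j| := by
      refine (abs_add_le _ _).trans (add_le_add ?_ le_rfl)
      refine (Finset.abs_sum_le_sum_abs _ _).trans (Finset.sum_le_sum fun i _ => ?_)
      rw [abs_mul]
      exact mul_le_mul_of_nonneg_right (abs_nodeVal_le θ x l i) (abs_nonneg _)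
    refine le_trans ?_ h
    rw [abs_of_nonneg (le_max_right _ _)]
    exact max_le (le_abs_self _) (abs_nonneg _)

/-- A node of path weight zero vanishes identically, so the convention `x / 0 = 0` makes
normalization harmless. -/
theorem pathWeight_mul_div (θ : SierNet d) (x : Cube d) (l : ℕ)
    (j : Fin (layerNodes d θ.width l)) :
    θ.pathWeight l j * (θ.nodeVal x l j / θ.pathWeight l j) = θ.nodeVal x l j := by
  rcases eq_or_ne (θ.pathWeight l j) 0 with h | h
  · have := θ.abs_nodeVal_le x l j
    rw [h] at this ⊢
    rw [zero_mul, abs_nonpos_iff.1 this]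
  · field_simp

end SierNet

/-! ### Rademacher complexity of networks, layer by layer. -/

section Complexity

variable {d n : ℕ} {S : Type*} (θ : S → SierNet d) (x : Fin n → Cube d) (a : Fin n → ℝ)

/-- The constant unit and the nodes of layer `l` of a family of networks, evaluated at the sample
points and normalized by their path weights. -/
noncomputable def normalizedNode (l : ℕ) :
    Option ((s : S) × Fin (layerNodes d (θ s).width l)) → Fin n → ℝ
  | none => fun _ => 1
  | some j => fun k => (θ j.1).nodeVal (x k) l j.2 / (θ j.1).pathWeight l j.2

/-- Largest absolute sign sum over the normalized nodes of layer `l`. -/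
noncomputable def nodeComplexity (l : ℕ) (r : Fin n → Bool) : ℝ :=
  ⨆ j, |∑ k, boolSign (r k) * (a k * normalizedNode θ x l j k)|

/-- The normalized arguments of the ReLU units in layer `l + 1`, and the constant unit. -/
noncomputable def normalizedPreactivation (l : ℕ) :
    Option ((s : S) × Fin (layerNodes d (θ s).width (l + 1))) → Fin n → ℝ
  | none => fun _ => 1
  | some j => fun k => (∑ i, (θ j.1).nodeVal (x k) l i * (θ j.1).W l i j.2 + (θ j.1).b l j.2) /
      (θ j.1).pathWeight (l + 1) j.2

/-- The positive part commutes with division by the nonnegative path weight and fixes the constant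
unit. -/
theorem normalizedNode_succ (l : ℕ) (j) (k : Fin n) :
    normalizedNode θ x (l + 1) j k = max (normalizedPreactivation θ x l j k) 0 := by
  cases j with
  | none => simp [normalizedNode, normalizedPreactivation]
  | some j =>
    have h := max_div_div_right ((θ j.1).pathWeight_nonneg (l + 1) j.2)
      (∑ i, (θ j.1).nodeVal (x k) l i * (θ j.1).W l i j.2 + (θ j.1).b l j.2) 0
    rw [zero_div] at h
    exact h.symm

/-- After normalization an input node is `x i` up to sign, or zero. All networks therefore share the
same `d + 1` functions, and the size of the family does not enter. -/
theorem sum_exp_nodeComplexity_zero_le {lam : ℝ} (hl : 0 ≤ lam) :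
    ∑ r : Fin n → Bool, Real.exp (lam * nodeComplexity θ x a 0 r) ≤
      2 ^ n * (2 * (d + 1 : ℝ) * Real.exp (lam ^ 2 * (∑ k, a k ^ 2) / 2)) := by
  have h := sum_signs_exp_iSup_abs_le (lam := lam)
    (fun (j : Option (Fin d)) (k : Fin n) => j.elim (1 : ℝ) fun i => (x k i : ℝ)) a (by
      intro j k
      cases j with
      | none => simp
      | some i => exact SierNet.abs_cube_le_one (x k) i)
  simp only [Fintype.card_option, Fintype.card_fin, Nat.cast_add, Nat.cast_one] at h
  refine le_trans (Finset.sum_le_sum fun r _ => ?_) h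
  refine Real.exp_le_exp.2 (mul_le_mul_of_nonneg_left (ciSup_le fun j => ?_) hl)
  have hb := Finite.bddAbove_range fun j : Option (Fin d) => |∑ k, boolSign (r k) *
    (a k * j.elim (1 : ℝ) fun i => (x k i : ℝ))|
  cases j with
  | none => exact le_ciSup hb none
  | some j =>
    obtain ⟨s, j⟩ := j
    change Fin d at j
    refine le_trans ?_ (le_ciSup hb (some j))
    simp only [Option.elim]
    have e : ∑ k, boolSign (r k) * (a k * normalizedNode θ x 0 (some ⟨s, j⟩) k) =
        ((θ s).β j / |(θ s).β j|) * ∑ k, boolSign (r k) * (a k * (x k j : ℝ)) := by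
      rw [Finset.mul_sum]
      refine Finset.sum_congr rfl fun k _ => ?_
      simp only [normalizedNode, SierNet.nodeVal, SierNet.pathWeight]
      ring
    rw [e, abs_mul, abs_div, abs_abs]
    exact mul_le_of_le_one_left (abs_nonneg _) (div_self_le_one _)

variable [Finite S]

theorem abs_sum_node_le (l : ℕ) (r : Fin n → Bool) (s : S)
    (i : Fin (layerNodes d (θ s).width l)) :
    |∑ k, boolSign (r k) * (a k * (θ s).nodeVal (x k) l i)| ≤
      (θ s).pathWeight l i * nodeComplexity θ x a l r := by
  have h := le_ciSup (Finite.bddAbove_range fun j =>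
    |∑ k, boolSign (r k) * (a k * normalizedNode θ x l j k)|) (some ⟨s, i⟩)
  have e : ∑ k, boolSign (r k) * (a k * (θ s).nodeVal (x k) l i) = (θ s).pathWeight l i *
      ∑ k, boolSign (r k) * (a k * normalizedNode θ x l (some ⟨s, i⟩) k) := by
    rw [Finset.mul_sum]
    refine Finset.sum_congr rfl fun k _ => ?_
    rw [← (θ s).pathWeight_mul_div (x k) l i]
    simp only [normalizedNode]
    ring
  rw [e, abs_mul, abs_of_nonneg ((θ s).pathWeight_nonneg l i)]
  exact mul_le_mul_of_nonneg_left h ((θ s).pathWeight_nonneg l i)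

theorem abs_sum_one_le (l : ℕ) (r : Fin n → Bool) :
    |∑ k, boolSign (r k) * a k| ≤ nodeComplexity θ x a l r := by
  have h := le_ciSup (Finite.bddAbove_range fun j =>
    |∑ k, boolSign (r k) * (a k * normalizedNode θ x l j k)|) none
  refine le_trans (le_of_eq ?_) h
  simp [normalizedNode]

theorem nodeComplexity_nonneg (l : ℕ) (r : Fin n → Bool) : 0 ≤ nodeComplexity θ x a l r :=
  (abs_nonneg _).trans (abs_sum_one_le θ x a l r)

theorem abs_sum_affine_le (l : ℕ) (r : Fin n → Bool) (s : S)
    (w : Fin (layerNodes d (θ s).width l) → ℝ) (b : ℝ) :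
    |∑ k, boolSign (r k) * (a k * (∑ i, (θ s).nodeVal (x k) l i * w i + b))| ≤
      (∑ i, (θ s).pathWeight l i * |w i| + |b|) * nodeComplexity θ x a l r := by
  have e : ∑ k, boolSign (r k) * (a k * (∑ i, (θ s).nodeVal (x k) l i * w i + b)) =
      ∑ i, (∑ k, boolSign (r k) * (a k * (θ s).nodeVal (x k) l i)) * w i +
        (∑ k, boolSign (r k) * a k) * b := by
    simp only [mul_add, Finset.sum_add_distrib, Finset.mul_sum, Finset.sum_mul]
    rw [Finset.sum_comm]
    simp only [mul_assoc]
  rw [e, add_mul]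
  refine (abs_add_le _ _).trans (add_le_add ?_ ?_)
  · rw [Finset.sum_mul]
    refine (Finset.abs_sum_le_sum_abs _ _).trans (Finset.sum_le_sum fun i _ => ?_)
    rw [abs_mul, mul_right_comm]
    exact mul_le_mul_of_nonneg_right (abs_sum_node_le θ x a l r s i) (abs_nonneg _)
  · rw [abs_mul, mul_comm]
    exact mul_le_mul_of_nonneg_left (abs_sum_one_le θ x a l r) (abs_nonneg _)

/-- The path weight of a unit is the total absolute weight of its incoming edges counted with the
path weights below, so normalized preactivations stay in the absolutely convex hull of the previous
layer, where a convex functional does not grow. -/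
theorem iSup_abs_preactivation_le (l : ℕ) (r : Fin n → Bool) :
    ⨆ j, |∑ k, boolSign (r k) * (a k * normalizedPreactivation θ x l j k)| ≤
      nodeComplexity θ x a l r := by
  refine ciSup_le fun j => ?_
  cases j with
  | none => simpa [normalizedPreactivation] using abs_sum_one_le θ x a l r
  | some j =>
    have h := abs_sum_affine_le θ x a l r j.1 (fun i => (θ j.1).W l i j.2) ((θ j.1).b l j.2)
    have e : ∑ k, boolSign (r k) * (a k * normalizedPreactivation θ x l (some j) k) =
        (∑ k, boolSign (r k) * (a k * (∑ i, (θ j.1).nodeVal (x k) l i * (θ j.1).W l i j.2 +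
          (θ j.1).b l j.2))) / (θ j.1).pathWeight (l + 1) j.2 := by
      rw [Finset.sum_div]
      refine Finset.sum_congr rfl fun k _ => ?_
      simp only [normalizedPreactivation]
      ring
    rw [e, abs_div, abs_of_nonneg ((θ j.1).pathWeight_nonneg (l + 1) j.2)]
    refine div_le_of_le_mul₀ ((θ j.1).pathWeight_nonneg (l + 1) j.2)
      (nodeComplexity_nonneg θ x a l r) ?_
    rw [mul_comm]
    exact h

theorem sum_exp_nodeComplexity_succ_le (l : ℕ) {lam : ℝ} (hl : 0 ≤ lam) :
    ∑ r : Fin n → Bool, Real.exp (lam * nodeComplexity θ x a (l + 1) r) ≤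
      2 * ∑ r : Fin n → Bool, Real.exp (lam * nodeComplexity θ x a l r) := by
  have h := sum_signs_exp_iSup_abs_posPart_le (normalizedPreactivation θ x l) a hl
  simp only [nodeComplexity, normalizedNode_succ]
  refine h.trans ?_
  gcongr with r
  exact iSup_abs_preactivation_le θ x a l r

theorem sum_exp_nodeComplexity_le (l : ℕ) {lam : ℝ} (hl : 0 ≤ lam) :
    ∑ r : Fin n → Bool, Real.exp (lam * nodeComplexity θ x a l r) ≤
      2 ^ l * (2 ^ n * (2 * (d + 1 : ℝ) * Real.exp (lam ^ 2 * (∑ k, a k ^ 2) / 2))) := by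
  induction l with
  | zero => simpa using sum_exp_nodeComplexity_zero_le θ x a hl
  | succ l ih =>
    refine (sum_exp_nodeComplexity_succ_le θ x a l hl).trans ?_
    rw [pow_succ]
    linarith

theorem abs_sum_eval_le (s : S) (r : Fin n → Bool) {M : ℝ}
    (hM : ∀ l ≤ (θ s).numHidden, nodeComplexity θ x a l r ≤ M) :
    |∑ k, boolSign (r k) * (a k * (θ s).eval (x k))| ≤ (θ s).totalVariation * M := by
  have e : ∑ k, boolSign (r k) * (a k * (θ s).eval (x k)) =
      ∑ l ∈ Finset.range ((θ s).numHidden + 1), (θ s).skipWeight l *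
        ∑ k, boolSign (r k) * (a k * (θ s).skipVal (x k) l) := by
    simp only [SierNet.eval, Finset.mul_sum]
    rw [Finset.sum_comm]
    exact Finset.sum_congr rfl fun l _ => Finset.sum_congr rfl fun k _ => by ring
  rw [e, SierNet.totalVariation, Finset.sum_mul]
  refine (Finset.abs_sum_le_sum_abs _ _).trans (Finset.sum_le_sum fun l hl => ?_)
  rw [abs_mul, abs_of_nonneg ((θ s).skipWeight_nonneg l), mul_assoc]
  refine mul_le_mul_of_nonneg_left ?_ ((θ s).skipWeight_nonneg l)
  refine (abs_sum_affine_le θ x a l r s _ _).trans (mul_le_mul_of_nonneg_left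
    (hM l (by simpa [Nat.lt_succ_iff] using hl)) ?_)
  exact add_nonneg (Finset.sum_nonneg fun i _ =>
    mul_nonneg ((θ s).pathWeight_nonneg l i) (abs_nonneg _)) (abs_nonneg _)

end Complexity

/-- Optimizes over the exponent; the minimizer is `√(2 log N) / √q`. For `q = 0` a positive `M` is
refuted by one sufficiently large `lam`. -/
theorem le_mul_sqrt_of_forall_exp {M N q : ℝ} (hN : 1 < N) (hq : 0 ≤ q)
    (h : ∀ lam, 0 ≤ lam → Real.exp (lam * M) ≤ N * Real.exp (lam ^ 2 * q / 2)) :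
    M ≤ Real.sqrt q * Real.sqrt (2 * Real.log N) := by
  have hlog := Real.log_pos hN
  have h' : ∀ lam, 0 ≤ lam → lam * M ≤ Real.log N + lam ^ 2 * q / 2 := by
    intro lam hl
    have := Real.log_le_log (Real.exp_pos _) (h lam hl)
    rwa [Real.log_exp, Real.log_mul (by positivity) (Real.exp_pos _).ne', Real.log_exp] at this
  rcases hq.eq_or_lt with rfl | hq
  · by_contra! hM
    simp only [Real.sqrt_zero, zero_mul] at hM
    have := h' (2 * Real.log N / M) (by positivity)
    rw [div_mul_cancel₀ _ hM.ne'] at this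
    linarith
  · set u := Real.sqrt q
    set v := Real.sqrt (2 * Real.log N)
    have hu : 0 < u := Real.sqrt_pos.2 hq
    have hv : 0 < v := Real.sqrt_pos.2 (by positivity)
    have hu2 : u ^ 2 = q := Real.sq_sqrt hq.le
    have hv2 : v ^ 2 = 2 * Real.log N := Real.sq_sqrt (by positivity)
    have := h' (v / u) (by positivity)
    rw [← hu2] at this
    have e : (v / u) ^ 2 * u ^ 2 = v ^ 2 := by field_simp
    rw [e] at this
    have h3 : v / u * M ≤ v ^ 2 := by linarith
    rw [div_mul_eq_mul_div, div_le_iff₀ hu] at h3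
    have : v * M ≤ v * (u * v) := by nlinarith
    exact le_of_mul_le_mul_left this hv

/-- Size-independent bound on the Rademacher complexity of finitely many networks, with weighted
signs. -/
theorem sum_signs_iSup_abs_eval_le {d n L : ℕ} {B : ℝ} {S : Type*} [Finite S] [Nonempty S]
    (hd : 1 ≤ d) (hL : 2 ≤ L) (θ : S → SierNet d) (hθ : ∀ s, (θ s).numLayers ≤ L)
    (hB : ∀ s, (θ s).totalVariation ≤ B) (x : Fin n → Cube d) (a : Fin n → ℝ) :
    ∑ r : Fin n → Bool, ⨆ s, |∑ k, boolSign (r k) * (a k * (θ s).eval (x k))| ≤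
      2 ^ n * (B * (Real.sqrt (∑ k, a k ^ 2) *
        Real.sqrt (2 * (L * Real.log 2 + Real.log (2 * d))))) := by
  have : Nonempty (Fin (L - 1)) := ⟨⟨0, by omega⟩⟩
  -- With at most `L` layers including the output, skip connections leave only layers `0, ..., L -
  -- 2`.
  set M : (Fin n → Bool) → ℝ := fun r => ⨆ l : Fin (L - 1), nodeComplexity θ x a l r with hM
  obtain ⟨s₀⟩ := ‹Nonempty S›
  have hB0 : 0 ≤ B := ((θ s₀).totalVariation_nonneg).trans (hB s₀)
  have hMl : ∀ r (l : Fin (L - 1)), nodeComplexity θ x a l r ≤ M r := fun r l =>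
    le_ciSup (Finite.bddAbove_range fun l : Fin (L - 1) => nodeComplexity θ x a l r) l
  have hM0 : ∀ r, 0 ≤ M r := fun r =>
    (nodeComplexity_nonneg θ x a _ r).trans (hMl r ⟨0, by omega⟩)
  have h1 : ∀ r, ⨆ s, |∑ k, boolSign (r k) * (a k * (θ s).eval (x k))| ≤ B * M r := by
    intro r
    have : Nonempty S := ⟨s₀⟩
    refine ciSup_le fun s => ?_
    refine (abs_sum_eval_le θ x a s r (M := M r) fun l hl => ?_).trans
      (mul_le_mul_of_nonneg_right (hB s) (hM0 r))
    have := hθ s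
    simp only [SierNet.numLayers] at this
    exact hMl r ⟨l, by omega⟩
  have hd' : (1 : ℝ) ≤ d := by exact_mod_cast hd
  have h2 : ∀ lam, 0 ≤ lam → ∑ r, Real.exp (lam * M r) ≤
      2 ^ n * (2 ^ L * (2 * d) * Real.exp (lam ^ 2 * (∑ k, a k ^ 2) / 2)) := by
    intro lam hl
    set E := Real.exp (lam ^ 2 * (∑ k, a k ^ 2) / 2)
    calc ∑ r, Real.exp (lam * M r)
        ≤ ∑ r, ∑ l : Fin (L - 1), Real.exp (lam * nodeComplexity θ x a l r) := by
          refine Finset.sum_le_sum fun r _ => ?_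
          obtain ⟨l, hl⟩ := exists_eq_ciSup_of_finite
            (f := fun l : Fin (L - 1) => nodeComplexity θ x a l r)
          rw [hM]
          simp only [← hl]
          exact Finset.single_le_sum (f := fun l : Fin (L - 1) =>
            Real.exp (lam * nodeComplexity θ x a l r)) (fun _ _ => (Real.exp_pos _).le)
            (Finset.mem_univ l)
      _ = ∑ l : Fin (L - 1), ∑ r, Real.exp (lam * nodeComplexity θ x a l r) := Finset.sum_comm
      _ ≤ ∑ l : Fin (L - 1), 2 ^ (l : ℕ) * (2 ^ n * (2 * (d + 1 : ℝ) * E)) :=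
          Finset.sum_le_sum fun l _ => sum_exp_nodeComplexity_le θ x a l hl
      -- The sum over layers is geometric, so the union over layers costs no more than one further
      -- doubling. Afterwards `d + 1 ≤ 2 * d` yields the `2 * d` of the final bound.
      _ = (2 ^ (L - 1) - 1) * (2 ^ n * (2 * (d + 1 : ℝ) * E)) := by
          rw [← Finset.sum_mul, Fin.sum_univ_eq_sum_range fun l => (2 : ℝ) ^ l,
            geom_sum_eq (by norm_num)]
          norm_num
      _ ≤ 2 ^ (L - 1) * (2 ^ n * (2 * (2 * d : ℝ) * E)) := by
          have : 0 < E := Real.exp_pos _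
          have h2 : (1 : ℝ) ≤ 2 ^ (L - 1) := one_le_pow₀ (by norm_num)
          gcongr <;> linarith
      _ = _ := by
          obtain ⟨L', rfl⟩ : ∃ L', L = L' + 1 := ⟨L - 1, by omega⟩
          simp only [Nat.add_sub_cancel, pow_succ]
          ring
  have h3 : (∑ r, M r) / 2 ^ n ≤ Real.sqrt (∑ k, a k ^ 2) *
      Real.sqrt (2 * Real.log (2 ^ L * (2 * d))) := by
    refine le_mul_sqrt_of_forall_exp ?_ (Finset.sum_nonneg fun _ _ => sq_nonneg _)
      fun lam hl => ?_
    · have : (1 : ℝ) ≤ 2 ^ L := one_le_pow₀ (by norm_num)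
      nlinarith
    -- Jensen's inequality for the uniform distribution on signs.
    · have hj := convexOn_exp.map_sum_le (t := Finset.univ) (w := fun _ : Fin n → Bool =>
        (1 / 2 ^ n : ℝ)) (p := fun r => lam * M r) (fun _ _ => by positivity) (by simp)
        (fun _ _ => Set.mem_univ _)
      simp only [smul_eq_mul, ← Finset.mul_sum] at hj
      have e : lam * ((∑ r, M r) / 2 ^ n) = 1 / 2 ^ n * (lam * ∑ r, M r) := by ring
      rw [e]
      refine hj.trans ?_
      rw [one_div, inv_mul_le_iff₀ (by positivity)]
      exact h2 lam hl
  have h4 : Real.log (2 ^ L * (2 * d)) = L * Real.log 2 + Real.log (2 * d) := by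
    rw [Real.log_mul (by positivity) (by positivity), Real.log_pow]
  rw [h4, div_le_iff₀' (by positivity)] at h3
  calc _ ≤ ∑ r, B * M r := Finset.sum_le_sum fun r _ => h1 r
    _ = B * ∑ r, M r := by rw [Finset.mul_sum]
    _ ≤ B * (2 ^ n * _) := mul_le_mul_of_nonneg_left h3 hB0
    _ = _ := by ring

/-! ### Maxima of Gaussian linear functionals: concentration and comparison with signs. -/

section GaussianMax

variable {n : ℕ} (v : NNReal)

theorem integrable_exp_linear_pi_gaussian (u : Fin n → ℝ) :
    Integrable (fun x : Fin n → ℝ => Real.exp (∑ k, u k * x k))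
      (Measure.pi fun _ => gaussianReal 0 v) := by
  simp only [Real.exp_sum]
  exact Integrable.fintype_prod (f := fun k y => Real.exp (u k * y))
    fun k => integrable_exp_mul_gaussianReal (u k)

theorem integral_exp_linear_pi_gaussian (u : Fin n → ℝ) :
    ∫ x : Fin n → ℝ, Real.exp (∑ k, u k * x k) ∂(Measure.pi fun _ => gaussianReal 0 v) =
      Real.exp (v * (∑ k, u k ^ 2) / 2) := by
  simp only [Real.exp_sum]
  rw [integral_fintype_prod_eq_prod fun k y => Real.exp (u k * y)]
  have h : ∀ k, ∫ y, Real.exp (u k * y) ∂(gaussianReal 0 v) = Real.exp (v * u k ^ 2 / 2) := by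
    intro k
    have := mgf_gaussianReal (p := gaussianReal 0 v) (X := id) (μ := 0) (v := v)
      (by rw [Measure.map_id]) (u k)
    simpa [mgf] using this
  simp only [h]
  rw [← Real.exp_sum, Finset.mul_sum, Finset.sum_div]

/-- The largest of finitely many linear functionals. -/
noncomputable def maxLinear {ι : Type*} (u : ι → Fin n → ℝ) (x : Fin n → ℝ) : ℝ :=
  ⨆ i, ∑ k, u i k * x k

variable {ι : Type*} [Finite ι] [Nonempty ι] (u : ι → Fin n → ℝ)

omit [Nonempty ι] in
theorem measurable_maxLinear : Measurable (maxLinear u) :=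
  Measurable.iSup fun i => by fun_prop

omit [Nonempty ι] in
theorem le_maxLinear (i : ι) (x : Fin n → ℝ) : ∑ k, u i k * x k ≤ maxLinear u x :=
  le_ciSup (Finite.bddAbove_range fun i => ∑ k, u i k * x k) i

theorem exists_eq_maxLinear (x : Fin n → ℝ) : ∃ i, ∑ k, u i k * x k = maxLinear u x :=
  exists_eq_ciSup_of_finite

theorem integrable_exp_maxLinear (t : ℝ) :
    Integrable (fun x => Real.exp (t * maxLinear u x)) (Measure.pi fun _ => gaussianReal 0 v) := by
  have := Fintype.ofFinite ι
  have h : Integrable (fun x : Fin n → ℝ => ∑ i, Real.exp (∑ k, t * u i k * x k))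
      (Measure.pi fun _ => gaussianReal 0 v) :=
    integrable_finsetSum _ fun i _ => integrable_exp_linear_pi_gaussian v fun k => t * u i k
  refine h.mono' ((measurable_maxLinear u).const_mul t).exp.aestronglyMeasurable
    (Filter.Eventually.of_forall fun x => ?_)
  obtain ⟨i, hi⟩ := exists_eq_maxLinear u x
  rw [Real.norm_eq_abs, Real.abs_exp, ← hi, Finset.mul_sum]
  simp only [← mul_assoc]
  exact Finset.single_le_sum (f := fun i => Real.exp (∑ k, t * u i k * x k))
    (fun _ _ => (Real.exp_pos _).le) (Finset.mem_univ i)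

theorem integrable_maxLinear :
    Integrable (maxLinear u) (Measure.pi fun _ => gaussianReal 0 v) := by
  refine ((integrable_exp_maxLinear v u 1).add (integrable_exp_maxLinear v u (-1))).mono'
    (measurable_maxLinear u).aestronglyMeasurable (Filter.Eventually.of_forall fun x => ?_)
  simp only [Pi.add_apply, one_mul, neg_one_mul, Real.norm_eq_abs]
  rcases abs_cases (maxLinear u x) with h | h <;> rw [h.1] <;>
    linarith [Real.add_one_le_exp (maxLinear u x), Real.add_one_le_exp (-maxLinear u x),
      Real.exp_pos (maxLinear u x), Real.exp_pos (-maxLinear u x)]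

/-- The planar rotation acts on each pair of coordinates separately. -/
theorem measurePreserving_rotation_pi_gaussian (θ : ℝ) :
    MeasurePreserving (fun p : (Fin n → ℝ) × (Fin n → ℝ) =>
        (Real.cos θ • p.1 + Real.sin θ • p.2, -Real.sin θ • p.1 + Real.cos θ • p.2))
      ((Measure.pi fun _ => gaussianReal 0 v).prod (Measure.pi fun _ => gaussianReal 0 v))
      ((Measure.pi fun _ => gaussianReal 0 v).prod (Measure.pi fun _ => gaussianReal 0 v)) := by
  have h1 : MeasurePreserving (ContinuousLinearMap.rotation θ : ℝ × ℝ →L[ℝ] ℝ × ℝ)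
      ((gaussianReal 0 v).prod (gaussianReal 0 v)) ((gaussianReal 0 v).prod (gaussianReal 0 v)) :=
    ⟨(ContinuousLinearMap.rotation θ).continuous.measurable,
      IsGaussian.map_rotation_eq_self (by simp) θ⟩
  have h2 := measurePreserving_pi (fun _ : Fin n => (gaussianReal 0 v).prod (gaussianReal 0 v))
    (fun _ => (gaussianReal 0 v).prod (gaussianReal 0 v)) fun _ => h1
  have h3 := measurePreserving_arrowProdEquivProdArrow ℝ ℝ (Fin n)
    (fun _ => gaussianReal 0 v) (fun _ => gaussianReal 0 v)
  exact (h3.comp h2).comp h3.symm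

/-- Exponential moment of one step of the rotation. -/
theorem lintegral_exp_rotation_step_le {r2 : ℝ} (hu : ∀ i, ∑ k, u i k ^ 2 ≤ r2) {t : ℝ}
    (ht : 0 ≤ t) (c s : ℝ) :
    ∫⁻ p, ENNReal.ofReal (Real.exp (t * (maxLinear u p.1 - maxLinear u (c • p.1 - s • p.2))))
      ∂((Measure.pi fun _ => gaussianReal 0 v).prod (Measure.pi fun _ => gaussianReal 0 v)) ≤
    ENNReal.ofReal (Real.exp ((t * s) ^ 2 * (v * r2) / 2) *
      mgf (maxLinear u) (Measure.pi fun _ => gaussianReal 0 v) (t * (1 - c))) := by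
  have hm := measurable_maxLinear u
  rw [lintegral_prod _ (by fun_prop)]
  have h1 : ∀ x : Fin n → ℝ, ∫⁻ y, ENNReal.ofReal (Real.exp
      (t * (maxLinear u x - maxLinear u (c • x - s • y)))) ∂(Measure.pi fun _ => gaussianReal 0 v) ≤
      ENNReal.ofReal (Real.exp ((t * s) ^ 2 * (v * r2) / 2) *
        Real.exp (t * (1 - c) * maxLinear u x)) := by
    intro x
    obtain ⟨i, hi⟩ := exists_eq_maxLinear u x
    calc _ ≤ ∫⁻ y, ENNReal.ofReal (Real.exp (t * (1 - c) * maxLinear u x) *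
          Real.exp (∑ k, t * s * u i k * y k)) ∂(Measure.pi fun _ => gaussianReal 0 v) := by
          refine lintegral_mono fun y => ENNReal.ofReal_le_ofReal ?_
          rw [← Real.exp_add]
          refine Real.exp_le_exp.2 ?_
          -- The functional that is maximal at `x` competes at the rotated point. It serves as a
          -- subgradient, so no differentiability of the maximum is needed, and the increment
          -- becomes linear in `y`.
          have h2 := le_maxLinear u i (c • x - s • y)
          have h3 : ∑ k, u i k * (c • x - s • y) k =
              c * maxLinear u x - s * ∑ k, u i k * y k := by
            rw [← hi, Finset.mul_sum, Finset.mul_sum, ← Finset.sum_sub_distrib]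
            refine Finset.sum_congr rfl fun k _ => ?_
            simp only [Pi.sub_apply, Pi.smul_apply, smul_eq_mul]
            ring
          have h4 : ∑ k, t * s * u i k * y k = t * (s * ∑ k, u i k * y k) := by
            simp only [Finset.mul_sum]
            exact Finset.sum_congr rfl fun k _ => by ring
          rw [h4, mul_assoc, ← mul_add]
          refine mul_le_mul_of_nonneg_left ?_ ht
          linarith
      _ = ENNReal.ofReal (Real.exp (t * (1 - c) * maxLinear u x) *
          Real.exp (v * (∑ k, (t * s * u i k) ^ 2) / 2)) := by
          rw [← ofReal_integral_eq_lintegral_ofReal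
            ((integrable_exp_linear_pi_gaussian v _).const_mul _)
            (Filter.Eventually.of_forall fun _ => by positivity), integral_const_mul,
            integral_exp_linear_pi_gaussian]
      _ ≤ _ := by
          rw [mul_comm]
          refine ENNReal.ofReal_le_ofReal (mul_le_mul_of_nonneg_right
            (Real.exp_le_exp.2 ?_) (Real.exp_pos _).le)
          have h5 : ∑ k, (t * s * u i k) ^ 2 = (t * s) ^ 2 * ∑ k, u i k ^ 2 := by
            rw [Finset.mul_sum]
            exact Finset.sum_congr rfl fun k _ => by ring
          rw [h5]
          have : (v : ℝ) * ((t * s) ^ 2 * ∑ k, u i k ^ 2) ≤ (t * s) ^ 2 * (v * r2) := by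
            rw [mul_left_comm]
            have := hu i
            gcongr
          linarith
  refine (lintegral_mono h1).trans ?_
  rw [← ofReal_integral_eq_lintegral_ofReal
    ((integrable_exp_maxLinear v u _).const_mul _)
    (Filter.Eventually.of_forall fun _ => by positivity), integral_const_mul]
  rfl

/-- A quarter turn carries one independent copy into the other. It is cut into `K` rotations by `θ`;
the increments telescope, Jensen's inequality replaces their sum by an average at `K` times the
exponent, and all steps obey the same bound by rotation invariance. -/
theorem lintegral_exp_maxLinear_sub_le_step {r2 : ℝ} (hu : ∀ i, ∑ k, u i k ^ 2 ≤ r2) {t : ℝ}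
    (ht : 0 ≤ t) (K : ℕ) (hK : 0 < K) (θ : ℝ) (hθ : K * θ = Real.pi / 2) :
    ∫⁻ p, ENNReal.ofReal (Real.exp (t * (maxLinear u p.2 - maxLinear u p.1)))
      ∂((Measure.pi fun _ => gaussianReal 0 v).prod (Measure.pi fun _ => gaussianReal 0 v)) ≤
    ENNReal.ofReal (Real.exp ((K * t * Real.sin θ) ^ 2 * (v * r2) / 2) *
      mgf (maxLinear u) (Measure.pi fun _ => gaussianReal 0 v) (K * t * (1 - Real.cos θ))) := by
  set B := ENNReal.ofReal (Real.exp ((K * t * Real.sin θ) ^ 2 * (v * r2) / 2) *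
      mgf (maxLinear u) (Measure.pi fun _ => gaussianReal 0 v) (K * t * (1 - Real.cos θ)))
  set Γ : Measure (Fin n → ℝ) := Measure.pi fun _ => gaussianReal 0 v
  have hm := measurable_maxLinear u
  let X : ℝ → (Fin n → ℝ) × (Fin n → ℝ) → (Fin n → ℝ) := fun φ p =>
    Real.cos φ • p.1 + Real.sin φ • p.2
  have hK' : (0 : ℝ) < K := by exact_mod_cast hK
  have step : ∀ j : ℕ, ∫⁻ p, ENNReal.ofReal (Real.exp (K * t *
      (maxLinear u (X ((j + 1 : ℕ) * θ) p) - maxLinear u (X (j * θ) p)))) ∂(Γ.prod Γ) ≤ B := by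
    intro j
    have h1 := lintegral_exp_rotation_step_le v u hu (mul_nonneg hK'.le ht) (Real.cos θ)
      (Real.sin θ)
    -- Rotating by `(j + 1) θ` gives again two independent Gaussian vectors; turning the first of
    -- them back by `θ` yields the position `X (j * θ)`.
    rw [← (measurePreserving_rotation_pi_gaussian v ((j + 1 : ℕ) * θ)).lintegral_comp
      (by fun_prop)] at h1
    refine le_trans (le_of_eq ?_) h1
    refine lintegral_congr fun p => ?_
    congr 6
    funext k
    simp only [X, Pi.add_apply, Pi.sub_apply, Pi.smul_apply, smul_eq_mul]
    have e : (j : ℝ) * θ = ((j + 1 : ℕ) : ℝ) * θ - θ := by push_cast; ring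
    rw [e, Real.cos_sub, Real.sin_sub]
    ring
  have hconv : ∀ p : (Fin n → ℝ) × (Fin n → ℝ),
      Real.exp (t * (maxLinear u p.2 - maxLinear u p.1)) ≤
      ∑ j ∈ Finset.range K, (1 / K : ℝ) * Real.exp (K * t *
        (maxLinear u (X ((j + 1 : ℕ) * θ) p) - maxLinear u (X (j * θ) p))) := by
    intro p
    have hj := convexOn_exp.map_sum_le (t := Finset.range K) (w := fun _ => (1 / K : ℝ))
      (p := fun j => K * t *
        (maxLinear u (X ((j + 1 : ℕ) * θ) p) - maxLinear u (X (j * θ) p)))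
      (fun _ _ => by positivity) (by simp [hK'.ne']) (fun _ _ => Set.mem_univ _)
    simp only [smul_eq_mul, ← Finset.mul_sum] at hj ⊢
    refine le_trans (le_of_eq ?_) hj
    congr 1
    rw [Finset.sum_range_sub (fun j : ℕ => maxLinear u (X (j * θ) p)), hθ]
    simp only [X, Real.cos_pi_div_two, Real.sin_pi_div_two, Nat.cast_zero, zero_mul, Real.cos_zero,
      Real.sin_zero, zero_smul, one_smul, zero_add, add_zero]
    field_simp
  calc _ ≤ ∫⁻ p, ∑ j ∈ Finset.range K, ENNReal.ofReal (1 / K) * ENNReal.ofReal (Real.exp (K * t *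
        (maxLinear u (X ((j + 1 : ℕ) * θ) p) - maxLinear u (X (j * θ) p)))) ∂(Γ.prod Γ) := by
        refine lintegral_mono fun p => ?_
        refine (ENNReal.ofReal_le_ofReal (hconv p)).trans (le_of_eq ?_)
        rw [ENNReal.ofReal_sum_of_nonneg fun _ _ => by positivity]
        exact Finset.sum_congr rfl fun j _ => ENNReal.ofReal_mul (by positivity)
    _ = ∑ j ∈ Finset.range K, ENNReal.ofReal (1 / K) * ∫⁻ p, ENNReal.ofReal (Real.exp (K * t *
        (maxLinear u (X ((j + 1 : ℕ) * θ) p) - maxLinear u (X (j * θ) p)))) ∂(Γ.prod Γ) := by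
        rw [lintegral_finsetSum _ fun j _ => by fun_prop]
        exact Finset.sum_congr rfl fun j _ => lintegral_const_mul _ (by fun_prop)
    _ ≤ ∑ _j ∈ Finset.range K, ENNReal.ofReal (1 / K) * B := by
        gcongr with j _
        exact step j
    _ = B := by
        rw [Finset.sum_const, Finset.card_range, nsmul_eq_mul, ← mul_assoc,
          ← ENNReal.ofReal_natCast, ← ENNReal.ofReal_mul hK'.le, mul_one_div_cancel hK'.ne',
          ENNReal.ofReal_one, one_mul]

/-- Lets the number of steps tend to infinity. Since `1 - cos θ` is quadratic in `θ`, the argument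
of the remaining moment generating function tends to zero; the variance factor stays bounded because
`K sin θ ≤ K θ = π / 2 ≤ 2`. -/
theorem lintegral_exp_maxLinear_sub_le {r2 : ℝ} (hu : ∀ i, ∑ k, u i k ^ 2 ≤ r2) {t : ℝ}
    (ht : 0 ≤ t) :
    ∫⁻ p, ENNReal.ofReal (Real.exp (t * (maxLinear u p.2 - maxLinear u p.1)))
      ∂((Measure.pi fun _ => gaussianReal 0 v).prod (Measure.pi fun _ => gaussianReal 0 v)) ≤
    ENNReal.ofReal (Real.exp (2 * t ^ 2 * (v * r2))) := by
  set Γ : Measure (Fin n → ℝ) := Measure.pi fun _ => gaussianReal 0 v with hΓ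
  obtain ⟨i₀⟩ := ‹Nonempty ι›
  have : Nonempty ι := ⟨i₀⟩
  have hr2 : 0 ≤ r2 := (Finset.sum_nonneg fun _ _ => sq_nonneg _).trans (hu i₀)
  let θ : ℕ → ℝ := fun K => Real.pi / 2 / ((K + 1 : ℕ) : ℝ)
  let c : ℕ → ℝ := fun K => ((K + 1 : ℕ) : ℝ) * t * (1 - Real.cos (θ K))
  have hc0 : ∀ K, 0 ≤ c K := fun K =>
    mul_nonneg (by positivity) (by linarith [Real.cos_le_one (θ K)])
  have hc1 : ∀ K, c K ≤ 2 * t * (1 / ((K : ℝ) + 1)) := by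
    intro K
    have h1 : 1 - Real.cos (θ K) ≤ θ K ^ 2 / 2 := by
      linarith [Real.one_sub_sq_div_two_le_cos (x := θ K)]
    have hp : Real.pi ^ 2 ≤ 4 ^ 2 := by
      have := Real.pi_le_four
      have := Real.pi_pos
      gcongr
    calc c K ≤ ((K + 1 : ℕ) : ℝ) * t * (θ K ^ 2 / 2) :=
          mul_le_mul_of_nonneg_left h1 (by positivity)
      _ = t * (1 / ((K : ℝ) + 1)) * (Real.pi ^ 2 / 8) := by
          simp only [θ]
          push_cast
          field_simp
          norm_num
      _ ≤ t * (1 / ((K : ℝ) + 1)) * 2 := by gcongr; linarith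
      _ = _ := by ring
  have hc : Filter.Tendsto c Filter.atTop (nhds 0) := by
    refine squeeze_zero hc0 hc1 ?_
    simpa using (tendsto_one_div_add_atTop_nhds_zero_nat (𝕜 := ℝ)).const_mul (2 * t)
  have hmgf : Filter.Tendsto (fun K => mgf (maxLinear u) Γ (c K)) Filter.atTop (nhds 1) := by
    have h1 : Continuous (mgf (maxLinear u) Γ) :=
      continuous_mgf fun s => integrable_exp_maxLinear v u s
    have h2 := (h1.tendsto 0).comp hc
    rwa [mgf_zero] at h2
  have hlim : Filter.Tendsto (fun K => ENNReal.ofReal (Real.exp (2 * t ^ 2 * (v * r2)) *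
      mgf (maxLinear u) Γ (c K))) Filter.atTop
      (nhds (ENNReal.ofReal (Real.exp (2 * t ^ 2 * (v * r2)) * 1))) :=
    (ENNReal.continuous_ofReal.tendsto _).comp (hmgf.const_mul _)
  rw [mul_one] at hlim
  refine ge_of_tendsto' hlim fun K => ?_
  have h := lintegral_exp_maxLinear_sub_le_step v u hu ht (K + 1) K.succ_pos (θ K) (by
    simp only [θ]
    field_simp)
  refine h.trans (ENNReal.ofReal_le_ofReal ?_)
  refine mul_le_mul_of_nonneg_right (Real.exp_le_exp.2 ?_) mgf_nonneg
  have hθ : 0 ≤ θ K := by positivity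
  have hs : (((K + 1 : ℕ) : ℝ) * Real.sin (θ K)) ^ 2 ≤ 2 ^ 2 := by
    refine pow_le_pow_left₀ (mul_nonneg (by positivity) (Real.sin_nonneg_of_nonneg_of_le_pi hθ ?_))
      ?_ 2
    · refine (div_le_self (by positivity) ?_).trans (by linarith [Real.pi_pos])
      push_cast
      linarith [(Nat.cast_nonneg K : (0 : ℝ) ≤ K)]
    · calc ((K + 1 : ℕ) : ℝ) * Real.sin (θ K) ≤ ((K + 1 : ℕ) : ℝ) * θ K :=
            mul_le_mul_of_nonneg_left (Real.sin_le hθ) (by positivity)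
        _ = Real.pi / 2 := by simp only [θ]; field_simp
        _ ≤ 2 := by linarith [Real.pi_le_four]
  have hv : 0 ≤ t ^ 2 * (v * r2) := by positivity
  calc (((K + 1 : ℕ) : ℝ) * t * Real.sin (θ K)) ^ 2 * (v * r2) / 2
      = (((K + 1 : ℕ) : ℝ) * Real.sin (θ K)) ^ 2 * (t ^ 2 * (v * r2)) / 2 := by ring
    _ ≤ 2 ^ 2 * (t ^ 2 * (v * r2)) / 2 := by gcongr
    _ = _ := by ring

/-- Sub-Gaussian moment bound for the largest of finitely many linear functionals of a Gaussian
vector, with a variance proxy that depends on the largest variance only. -/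
theorem mgf_maxLinear_le {r2 : ℝ} (hu : ∀ i, ∑ k, u i k ^ 2 ≤ r2) {t : ℝ} (ht : 0 ≤ t) :
    mgf (maxLinear u) (Measure.pi fun _ => gaussianReal 0 v) t ≤
      Real.exp (t * ∫ x, maxLinear u x ∂(Measure.pi fun _ => gaussianReal 0 v) +
        2 * t ^ 2 * (v * r2)) := by
  set Γ : Measure (Fin n → ℝ) := Measure.pi fun _ => gaussianReal 0 v with hΓ
  have h1 := lintegral_exp_maxLinear_sub_le v u hu ht
  have hi := (integrable_exp_maxLinear v u (-t)).mul_prod (integrable_exp_maxLinear v u t)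
  have e : (fun p : (Fin n → ℝ) × (Fin n → ℝ) =>
      Real.exp (t * (maxLinear u p.2 - maxLinear u p.1))) =
      fun p => Real.exp (-t * maxLinear u p.1) * Real.exp (t * maxLinear u p.2) := by
    funext p
    rw [← Real.exp_add]
    ring_nf
  have h2 := integral_prod_mul (μ := Γ) (ν := Γ) (fun x => Real.exp (-t * maxLinear u x))
    (fun x => Real.exp (t * maxLinear u x))
  rw [← e] at h2 hi
  rw [← ofReal_integral_eq_lintegral_ofReal hi (Filter.Eventually.of_forall fun _ =>
    (Real.exp_pos _).le), ENNReal.ofReal_le_ofReal_iff (Real.exp_pos _).le, h2] at h1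
  -- The independent copy is replaced by its mean through Jensen's inequality.
  have h3 : Real.exp (-t * ∫ x, maxLinear u x ∂Γ) ≤ ∫ x, Real.exp (-t * maxLinear u x) ∂Γ := by
    rw [← integral_const_mul]
    exact convexOn_exp.map_integral_le Real.continuous_exp.continuousOn isClosed_univ
      (Filter.Eventually.of_forall fun _ => Set.mem_univ _)
      ((integrable_maxLinear v u).const_mul _) (integrable_exp_maxLinear v u (-t))
  have h4 : Real.exp (-t * ∫ x, maxLinear u x ∂Γ) * mgf (maxLinear u) Γ t ≤
      Real.exp (2 * t ^ 2 * (v * r2)) :=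
    (mul_le_mul_of_nonneg_right h3 mgf_nonneg).trans h1
  rw [neg_mul, Real.exp_neg, inv_mul_le_iff₀ (Real.exp_pos _)] at h4
  rwa [Real.exp_add]

theorem measure_le_maxLinear_le {r2 : ℝ} (hu : ∀ i, ∑ k, u i k ^ 2 ≤ r2) {t : ℝ} (ht : 0 ≤ t)
    (y : ℝ) :
    (Measure.pi fun _ => gaussianReal 0 v).real {x | y ≤ maxLinear u x} ≤
      Real.exp (-t * (y - ∫ x, maxLinear u x ∂(Measure.pi fun _ => gaussianReal 0 v)) +
        2 * t ^ 2 * (v * r2)) := by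
  refine (measure_ge_le_exp_mul_mgf y ht (integrable_exp_maxLinear v u t)).trans ?_
  refine (mul_le_mul_of_nonneg_left (mgf_maxLinear_le v u hu ht) (Real.exp_pos _).le).trans
    (le_of_eq ?_)
  rw [← Real.exp_add]
  ring_nf

theorem measurePreserving_signs_pi_gaussian (r : Fin n → Bool) :
    MeasurePreserving (fun (x : Fin n → ℝ) k => boolSign (r k) * x k)
      (Measure.pi fun _ => gaussianReal 0 v) (Measure.pi fun _ => gaussianReal 0 v) := by
  refine measurePreserving_pi (fun _ : Fin n => gaussianReal 0 v) (fun _ => gaussianReal 0 v)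
    (f := fun k y => boolSign (r k) * y) fun k => ⟨by fun_prop, ?_⟩
  cases r k
  · simp [gaussianReal_map_neg]
  · simp

theorem integrable_sum_sq_pi_gaussian :
    Integrable (fun x : Fin n → ℝ => ∑ k, x k ^ 2) (Measure.pi fun _ => gaussianReal 0 v) :=
  integrable_finsetSum _ fun k _ => integrable_comp_eval (μ := fun _ : Fin n => gaussianReal 0 v)
    (i := k) (f := fun y : ℝ => y ^ 2) (memLp_id_gaussianReal 2).integrable_sq

theorem integral_sum_sq_pi_gaussian :
    ∫ x : Fin n → ℝ, ∑ k, x k ^ 2 ∂(Measure.pi fun _ => gaussianReal 0 v) = n * v := by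
  have h1 : ∫ y, y ^ 2 ∂(gaussianReal 0 v) = v := by
    have h := variance_id_gaussianReal (μ := 0) (v := v)
    rw [variance_eq_integral (by fun_prop)] at h
    simpa using h
  rw [integral_finsetSum _ fun k _ => integrable_comp_eval
    (μ := fun _ : Fin n => gaussianReal 0 v) (i := k) (f := fun y : ℝ => y ^ 2)
    (memLp_id_gaussianReal 2).integrable_sq]
  have h2 : ∀ k : Fin n, ∫ x : Fin n → ℝ, x k ^ 2 ∂(Measure.pi fun _ => gaussianReal 0 v) = v := by
    intro k
    rw [← h1]
    exact integral_comp_eval (μ := fun _ : Fin n => gaussianReal 0 v) (i := k)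
      (f := fun y : ℝ => y ^ 2) (by fun_prop)
  simp [h2]

/-- Gaussian complexity is controlled by a weighted Rademacher complexity. -/
theorem integral_maxLinear_le_of_sum_signs {C : ℝ} (hC0 : 0 ≤ C)
    (hC : ∀ a : Fin n → ℝ, ∑ r : Fin n → Bool, ⨆ i, |∑ k, boolSign (r k) * (a k * u i k)| ≤
      2 ^ n * (C * Real.sqrt (∑ k, a k ^ 2))) :
    ∫ x, maxLinear u x ∂(Measure.pi fun _ => gaussianReal 0 v) ≤ C * Real.sqrt (n * v) := by
  set Γ : Measure (Fin n → ℝ) := Measure.pi fun _ => gaussianReal 0 v with hΓ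
  have hint : ∀ r : Fin n → Bool,
      Integrable (fun x => maxLinear u fun k => boolSign (r k) * x k) Γ := fun r =>
    (measurePreserving_signs_pi_gaussian v r).integrable_comp_of_integrable
      (integrable_maxLinear v u)
  have h1 : ∀ r : Fin n → Bool,
      ∫ x, maxLinear u (fun k => boolSign (r k) * x k) ∂Γ = ∫ x, maxLinear u x ∂Γ := by
    intro r
    have h := measurePreserving_signs_pi_gaussian v r
    conv_rhs => rw [hΓ, ← h.map_eq]
    rw [integral_map h.measurable.aemeasurable
      (measurable_maxLinear u).aestronglyMeasurable]
  have hsq : Integrable (fun x : Fin n → ℝ => Real.sqrt (∑ k, x k ^ 2)) Γ := by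
    refine ((integrable_const 1).add (integrable_sum_sq_pi_gaussian v)).mono'
      (Measurable.sqrt (by fun_prop)).aestronglyMeasurable
      (Filter.Eventually.of_forall fun x => ?_)
    have h0 : 0 ≤ ∑ k, x k ^ 2 := Finset.sum_nonneg fun _ _ => sq_nonneg _
    rw [Real.norm_eq_abs, abs_of_nonneg (Real.sqrt_nonneg _)]
    exact Real.sqrt_le_iff.2 ⟨by simp only [Pi.add_apply]; linarith, by
      simp only [Pi.add_apply]; nlinarith⟩
  have h2 : ∀ x : Fin n → ℝ, ∑ r : Fin n → Bool, maxLinear u (fun k => boolSign (r k) * x k) ≤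
      2 ^ n * (C * Real.sqrt (∑ k, x k ^ 2)) := by
    -- The Gaussian vector itself serves as the vector of weights of the signs. Since it has a
    -- sign-symmetric law, only the mean of its Euclidean norm remains, and no logarithm is lost.
    intro x
    refine (Finset.sum_le_sum fun r _ => ?_).trans (hC x)
    refine ciSup_le fun i => ?_
    refine le_trans (le_of_eq ?_) ((le_abs_self _).trans (le_ciSup (Finite.bddAbove_range
      fun i => |∑ k, boolSign (r k) * (x k * u i k)|) i))
    exact Finset.sum_congr rfl fun k _ => by ring
  have h3 : ∫ x : Fin n → ℝ, Real.sqrt (∑ k, x k ^ 2) ∂Γ ≤ Real.sqrt (n * v) := by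
    rw [← integral_sum_sq_pi_gaussian v]
    exact Real.strictConcaveOn_sqrt.concaveOn.le_map_integral
      Real.continuous_sqrt.continuousOn isClosed_Ici
      (Filter.Eventually.of_forall fun x => Set.mem_Ici.2
        (Finset.sum_nonneg fun _ _ => sq_nonneg _))
      (integrable_sum_sq_pi_gaussian v) hsq
  have h4 : 2 ^ n * ∫ x, maxLinear u x ∂Γ ≤ 2 ^ n * (C * Real.sqrt (n * v)) := by
    calc 2 ^ n * ∫ x, maxLinear u x ∂Γ
        = ∑ r : Fin n → Bool, ∫ x, maxLinear u (fun k => boolSign (r k) * x k) ∂Γ := by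
          simp [h1]
      _ = ∫ x, ∑ r : Fin n → Bool, maxLinear u (fun k => boolSign (r k) * x k) ∂Γ :=
          (integral_finsetSum _ fun r _ => hint r).symm
      _ ≤ ∫ x : Fin n → ℝ, 2 ^ n * (C * Real.sqrt (∑ k, x k ^ 2)) ∂Γ :=
          integral_mono (integrable_finsetSum _ fun r _ => hint r)
            ((hsq.const_mul C).const_mul _) h2
      _ = 2 ^ n * (C * ∫ x : Fin n → ℝ, Real.sqrt (∑ k, x k ^ 2) ∂Γ) := by
          rw [integral_const_mul, integral_const_mul]
      _ ≤ _ := by gcongr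
  exact le_of_mul_le_mul_left h4 (by positivity)

end GaussianMax

/-! ### Exponential moments under bounded differences. -/

section BoundedDifferences

variable {X : Type*} [MeasurableSpace X] (μ : Measure X) [IsProbabilityMeasure μ]

/-- Hoeffding's lemma: bounded oscillation confines `g` to an interval of length `c` starting at its
infimum. -/
theorem integral_exp_le_of_oscillation_le {g : X → ℝ} (hg : Measurable g) {c : ℝ}
    (hc : ∀ x y, |g x - g y| ≤ c) (t : ℝ) :
    ∫ x, Real.exp (t * g x) ∂μ ≤ Real.exp (t * ∫ x, g x ∂μ + t ^ 2 * c ^ 2 / 8) := by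
  obtain ⟨x₀⟩ : Nonempty X := nonempty_of_isProbabilityMeasure μ
  have : Nonempty X := ⟨x₀⟩
  have hb : BddBelow (Set.range g) :=
    ⟨g x₀ - c, by rintro _ ⟨y, rfl⟩; linarith [(abs_le.1 (hc x₀ y)).2]⟩
  have hmem : ∀ x, g x ∈ Set.Icc (⨅ y, g y) ((⨅ y, g y) + c) := fun x =>
    ⟨ciInf_le hb x, by
      have : g x - c ≤ ⨅ y, g y := le_ciInf fun y => by linarith [(abs_le.1 (hc x y)).2]
      linarith⟩
  have h := (hasSubgaussianMGF_of_mem_Icc hg.aemeasurable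
    (Filter.Eventually.of_forall hmem : ∀ᵐ x ∂μ, _)).mgf_le t
  have e : mgf (fun x => g x - ∫ x, g x ∂μ) μ t =
      (∫ x, Real.exp (t * g x) ∂μ) * Real.exp (-(t * ∫ x, g x ∂μ)) := by
    rw [mgf, ← integral_mul_const]
    refine integral_congr_ae (Filter.Eventually.of_forall fun x => ?_)
    simp only
    rw [← Real.exp_add]
    ring_nf
  rw [e, Real.exp_neg, ← div_eq_mul_inv, div_le_iff₀ (Real.exp_pos _), ← Real.exp_add] at h
  refine h.trans (Real.exp_le_exp.2 (le_of_eq ?_))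
  simp only [add_sub_cancel_left, NNReal.coe_pow, NNReal.coe_div, coe_nnnorm, NNReal.coe_ofNat,
    Real.norm_eq_abs, div_pow, sq_abs]
  ring

theorem integrable_of_abs_le {Y : Type*} [MeasurableSpace Y] (ν : Measure Y) [IsFiniteMeasure ν]
    {f : Y → ℝ} (hf : Measurable f) {M : ℝ} (hM : ∀ x, |f x| ≤ M) : Integrable f ν :=
  Integrable.of_bound hf.aestronglyMeasurable M (Filter.Eventually.of_forall hM)

theorem integral_pi_succ {n : ℕ} {f : (Fin (n + 1) → X) → ℝ}
    (hf : Integrable f (Measure.pi fun _ => μ)) :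
    ∫ x, f x ∂(Measure.pi fun _ => μ) =
      ∫ z, ∫ y, f (Fin.cons y z) ∂μ ∂(Measure.pi fun _ : Fin n => μ) := by
  have h := (measurePreserving_piFinSuccAbove (fun _ : Fin (n + 1) => μ) 0).symm
  rw [← h.integral_comp (MeasurableEquiv.measurableEmbedding _)]
  have hi := h.integrable_comp_of_integrable hf
  refine (integral_prod_symm _ hi).trans ?_
  simp [MeasurableEquiv.piFinSuccAbove_symm_apply, Fin.insertNthEquiv, Fin.insertNth_zero']

/-- Exponential moment form of the bounded differences inequality. -/
theorem integral_exp_le_of_bounded_differences {n : ℕ} {f : (Fin n → X) → ℝ} (hf : Measurable f)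
    {M : ℝ} (hM : ∀ x, |f x| ≤ M) {c : ℝ}
    (hc : ∀ x k y, |f (Function.update x k y) - f x| ≤ c) (t : ℝ) :
    ∫ x, Real.exp (t * f x) ∂(Measure.pi fun _ => μ) ≤
      Real.exp (t * ∫ x, f x ∂(Measure.pi fun _ => μ) + n * (t ^ 2 * c ^ 2 / 8)) := by
  induction n with
  | zero =>
    have : ∀ x, f x = f default := fun x => congrArg f (Subsingleton.elim _ _)
    simp [this]
  | succ n ih =>
    have hexp : ∀ {y : ℝ}, |y| ≤ M → |Real.exp (t * y)| ≤ Real.exp (|t| * M) := by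
      intro y hy
      rw [Real.abs_exp]
      refine Real.exp_le_exp.2 ((le_abs_self _).trans ?_)
      rw [abs_mul]
      gcongr
    have hcons : Measurable fun p : (Fin n → X) × X =>
        f (Fin.cons p.2 p.1 : Fin (n + 1) → X) := by
      refine hf.comp (measurable_pi_iff.2 fun i => ?_)
      refine Fin.cases ?_ (fun j => ?_) i
      · exact measurable_snd
      · exact (measurable_pi_apply j).comp measurable_fst
    -- Averaging out the first coordinate preserves the bounded differences in the others, while
    -- Hoeffding's lemma in that coordinate costs `t ^ 2 * c ^ 2 / 8`.
    set F : (Fin n → X) → ℝ := fun z => ∫ y, f (Fin.cons y z) ∂μ with hF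
    have hFm : Measurable F := hcons.stronglyMeasurable.integral_prod_right.measurable
    have hsec : ∀ z : Fin n → X, Measurable fun y => f (Fin.cons y z : Fin (n + 1) → X) :=
      fun z => hcons.comp measurable_prodMk_left
    have hFM : ∀ z, |F z| ≤ M := by
      intro z
      simpa using norm_integral_le_of_norm_le_const (μ := μ)
        (f := fun y => f (Fin.cons y z : Fin (n + 1) → X))
        (Filter.Eventually.of_forall fun y => hM _)
    have hFc : ∀ z k y, |F (Function.update z k y) - F z| ≤ c := by
      intro z k y
      simp only [hF]
      rw [← integral_sub (integrable_of_abs_le μ (hsec _) fun _ => hM _)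
        (integrable_of_abs_le μ (hsec _) fun _ => hM _)]
      have := norm_integral_le_of_norm_le_const (μ := μ) (C := c)
        (f := fun w => f (Fin.cons w (Function.update z k y) : Fin (n + 1) → X) -
          f (Fin.cons w z)) (Filter.Eventually.of_forall fun w => by
            rw [Fin.cons_update]
            exact hc _ _ _)
      simpa using this
    have hosc : ∀ z x y, |f (Fin.cons x z : Fin (n + 1) → X) - f (Fin.cons y z)| ≤ c := by
      intro z x y
      have := hc (Fin.cons y z : Fin (n + 1) → X) 0 x
      rwa [Fin.update_cons_zero] at this
    have hE : Integrable (fun x => Real.exp (t * f x)) (Measure.pi fun _ : Fin (n + 1) => μ) :=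
      integrable_of_abs_le _ (hf.const_mul t).exp fun x => hexp (hM x)
    rw [integral_pi_succ μ hE,
      integral_pi_succ μ (integrable_of_abs_le _ hf hM)]
    calc _ ≤ ∫ z, Real.exp (t ^ 2 * c ^ 2 / 8) * Real.exp (t * F z)
          ∂(Measure.pi fun _ : Fin n => μ) := by
          refine integral_mono ?_ ?_ fun z => ?_
          · refine integrable_of_abs_le _ (M := Real.exp (|t| * M)) ?_ fun z => ?_
            · exact (hcons.const_mul t).exp.stronglyMeasurable.integral_prod_right.measurable
            · simpa using norm_integral_le_of_norm_le_const (μ := μ)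
                (f := fun y => Real.exp (t * f (Fin.cons y z : Fin (n + 1) → X)))
                (Filter.Eventually.of_forall fun y => hexp (hM _))
          · exact (integrable_of_abs_le _ (hFm.const_mul t).exp fun z => hexp (hFM z)).const_mul _
          · simp only
            rw [← Real.exp_add, add_comm (t ^ 2 * c ^ 2 / 8) (t * F z)]
            exact integral_exp_le_of_oscillation_le μ (hsec z) (hosc z) t
      _ = Real.exp (t ^ 2 * c ^ 2 / 8) * ∫ z, Real.exp (t * F z)
          ∂(Measure.pi fun _ : Fin n => μ) := integral_const_mul _ _
      _ ≤ Real.exp (t ^ 2 * c ^ 2 / 8) * _ :=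
          mul_le_mul_of_nonneg_left (ih hFm hFM hFc) (Real.exp_pos _).le
      _ = _ := by
          rw [← Real.exp_add]
          congr 1
          push_cast
          ring

end BoundedDifferences

/-! ### Symmetrization with an independent copy of the sample. -/

section Symmetrization

variable {X : Type*} [MeasurableSpace X] (μ : Measure X) [IsProbabilityMeasure μ] {n : ℕ}

/-- Exchanging a point with its independent copy flips the sign of the corresponding difference. -/
theorem measurePreserving_coordinateSwap (r : Fin n → Bool) :
    MeasurePreserving (fun p : (Fin n → X) × (Fin n → X) =>
        ((fun k => if r k then p.1 k else p.2 k), fun k => if r k then p.2 k else p.1 k))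
      ((Measure.pi fun _ => μ).prod (Measure.pi fun _ => μ))
      ((Measure.pi fun _ => μ).prod (Measure.pi fun _ => μ)) := by
  have h1 : ∀ k, MeasurePreserving (fun q : X × X => if r k then q else q.swap)
      (μ.prod μ) (μ.prod μ) := by
    intro k
    cases r k
    · simpa using Measure.measurePreserving_swap (μ := μ) (ν := μ)
    · exact MeasurePreserving.id (μ.prod μ)
  have h2 := measurePreserving_pi (fun _ : Fin n => μ.prod μ) (fun _ => μ.prod μ) h1
  have h3 := measurePreserving_arrowProdEquivProdArrow X X (Fin n) (fun _ => μ) (fun _ => μ)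
  have h4 := (h3.comp h2).comp h3.symm
  convert h4 using 1
  funext p
  refine Prod.ext (funext fun k => ?_) (funext fun k => ?_)
  · change (if r k then p.1 k else p.2 k) = (if r k then (p.1 k, p.2 k) else (p.2 k, p.1 k)).1
    split_ifs <;> rfl
  · change (if r k then p.2 k else p.1 k) = (if r k then (p.1 k, p.2 k) else (p.2 k, p.1 k)).2
    split_ifs <;> rfl

theorem abs_iSup_le_of_abs_le {ι : Type*} [Finite ι] [Nonempty ι] {f : ι → ℝ} {M : ℝ}
    (h : ∀ i, |f i| ≤ M) : |⨆ i, f i| ≤ M := by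
  obtain ⟨i, hi⟩ := exists_eq_ciSup_of_finite (f := f)
  rw [← hi]
  exact h i

/-- Symmetrization for finitely many bounded functions. -/
theorem integral_iSup_sub_le_of_sum_signs {ι : Type*} [Finite ι] [Nonempty ι] {h : ι → X → ℝ}
    (hm : ∀ i, Measurable (h i)) {M : ℝ} (hM : ∀ i x, |h i x| ≤ M) {C : ℝ}
    (hC : ∀ x : Fin n → X, ∑ r : Fin n → Bool, ⨆ i, ∑ k, boolSign (r k) * h i (x k) ≤ 2 ^ n * C) :
    ∫ x, ⨆ i, ∑ k, (∫ y, h i y ∂μ - h i (x k)) ∂(Measure.pi fun _ : Fin n => μ) ≤ 2 * C := by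
  set π : Measure (Fin n → X) := Measure.pi fun _ => μ with hπ
  let G : (Fin n → Bool) → (Fin n → X) × (Fin n → X) → ℝ := fun r p =>
    ⨆ i, ∑ k, boolSign (r k) * (h i (p.1 k) - h i (p.2 k))
  have hsum : ∀ s : Fin n → ℝ, (∀ k, |s k| ≤ 2 * M) → |∑ k, s k| ≤ n * (2 * M) := by
    intro s hs
    refine (Finset.abs_sum_le_sum_abs _ _).trans ((Finset.sum_le_sum fun k _ => hs k).trans ?_)
    simp
  have hdiff : ∀ i x y, |h i x - h i y| ≤ 2 * M := by
    intro i x y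
    have := abs_sub (h i x) (h i y)
    linarith [hM i x, hM i y]
  have hmean : ∀ i, |∫ y, h i y ∂μ| ≤ M := by
    intro i
    simpa using norm_integral_le_of_norm_le_const (μ := μ) (f := h i)
      (Filter.Eventually.of_forall fun y => hM i y)
  have hGm : ∀ r, Measurable (G r) := fun r => Measurable.iSup fun i => by fun_prop
  have hGi : ∀ r, Integrable (G r) (π.prod π) := by
    intro r
    refine integrable_of_abs_le _ (hGm r) (M := n * (2 * M)) fun p =>
      abs_iSup_le_of_abs_le fun i => hsum _ fun k => ?_
    rw [abs_mul, abs_boolSign, one_mul]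
    exact hdiff _ _ _
  have hGr : ∀ r, ∫ p, G r p ∂(π.prod π) = ∫ p, G (fun _ => true) p ∂(π.prod π) := by
    intro r
    have hT := measurePreserving_coordinateSwap μ r
    conv_rhs => rw [hπ, ← hT.map_eq]
    rw [integral_map hT.measurable.aemeasurable (hGm _).aestronglyMeasurable]
    refine integral_congr_ae (Filter.Eventually.of_forall fun p => ?_)
    refine iSup_congr fun i => Finset.sum_congr rfl fun k _ => ?_
    cases hrk : r k <;> simp [hrk]
  have hDi : Integrable (fun x => ⨆ i, ∑ k, (∫ y, h i y ∂μ - h i (x k))) π := by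
    refine integrable_of_abs_le _ (Measurable.iSup fun i => by fun_prop) (M := n * (2 * M))
      fun x => abs_iSup_le_of_abs_le fun i => hsum _ fun k => ?_
    have := abs_sub (∫ y, h i y ∂μ) (h i (x k))
    linarith [hM i (x k), hmean i]
  -- The means are expectations over the second sample, and a supremum of expectations is at most
  -- the expectation of the supremum.
  have hD : ∫ x, ⨆ i, ∑ k, (∫ y, h i y ∂μ - h i (x k)) ∂π ≤
      ∫ p, G (fun _ => true) p ∂(π.prod π) := by
    rw [integral_prod_symm _ (hGi _)]
    refine integral_mono hDi (hGi _).integral_prod_right fun x => ciSup_le fun i => ?_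
    have e : ∑ k, (∫ y, h i y ∂μ - h i (x k)) = ∫ x', ∑ k, (h i (x' k) - h i (x k)) ∂π := by
      rw [integral_finsetSum _ fun k _ => integrable_of_abs_le _ (by fun_prop) fun x' =>
        hdiff i (x' k) (x k)]
      refine Finset.sum_congr rfl fun k _ => ?_
      rw [integral_sub (integrable_of_abs_le π (f := fun x' : Fin n → X => h i (x' k))
        (by fun_prop) fun x' => hM i (x' k))
        (integrable_const _), integral_const,
        integral_comp_eval (μ := fun _ : Fin n => μ) (hm i).aestronglyMeasurable]
      simp
    rw [e]
    refine integral_mono (integrable_of_abs_le _ (by fun_prop) fun x' =>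
      hsum _ fun k => hdiff i (x' k) (x k)) (integrable_of_abs_le _
      ((hGm _).comp measurable_prodMk_right) (M := n * (2 * M)) fun x' =>
      abs_iSup_le_of_abs_le fun i => hsum _ fun k => by simpa using hdiff i (x' k) (x k))
      fun x' => ?_
    have := le_ciSup (Finite.bddAbove_range fun i => ∑ k, (h i (x' k) - h i (x k))) i
    simpa [G] using this
  have hpt : ∀ p : (Fin n → X) × (Fin n → X), ∑ r, G r p ≤ 2 ^ n * (2 * C) := by
    intro p
    have h2 := sum_signs_neg (n := n) fun s => ⨆ i, ∑ k, s k * h i (p.2 k)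
    have h3 : ∀ r, G r p ≤ (⨆ i, ∑ k, boolSign (r k) * h i (p.1 k)) +
        ⨆ i, ∑ k, -boolSign (r k) * h i (p.2 k) := by
      intro r
      refine ciSup_le fun i => ?_
      have e : ∑ k, boolSign (r k) * (h i (p.1 k) - h i (p.2 k)) =
          ∑ k, boolSign (r k) * h i (p.1 k) + ∑ k, -boolSign (r k) * h i (p.2 k) := by
        rw [← Finset.sum_add_distrib]
        exact Finset.sum_congr rfl fun k _ => by ring
      rw [e]
      exact add_le_add
        (le_ciSup (Finite.bddAbove_range fun i => ∑ k, boolSign (r k) * h i (p.1 k)) i)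
        (le_ciSup (Finite.bddAbove_range fun i => ∑ k, -boolSign (r k) * h i (p.2 k)) i)
    calc ∑ r, G r p ≤ _ := Finset.sum_le_sum fun r _ => h3 r
      _ = ∑ r : Fin n → Bool, (⨆ i, ∑ k, boolSign (r k) * h i (p.1 k)) +
          ∑ r : Fin n → Bool, ⨆ i, ∑ k, boolSign (r k) * h i (p.2 k) := by
          rw [Finset.sum_add_distrib, h2]
      _ ≤ _ := by linarith [hC p.1, hC p.2]
  have h4 : 2 ^ n * ∫ p, G (fun _ => true) p ∂(π.prod π) ≤ 2 ^ n * (2 * C) := by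
    calc _ = ∑ r, ∫ p, G r p ∂(π.prod π) := by simp [hGr]
      _ = ∫ p, ∑ r, G r p ∂(π.prod π) := (integral_finsetSum _ fun r _ => hGi r).symm
      _ ≤ ∫ _p, 2 ^ n * (2 * C) ∂(π.prod π) :=
          integral_mono (integrable_finsetSum _ fun r _ => hGi r) (integrable_const _) hpt
      _ = _ := by simp
  exact hD.trans (le_of_mul_le_mul_left h4 (by positivity))

end Symmetrization

/-! ### Continuity of networks and convexity of the class. -/

namespace SierNet

variable {d : ℕ}

theorem continuous_nodeVal (θ : SierNet d) :
    ∀ l j, Continuous fun x : Cube d => θ.nodeVal x l j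
  | 0, j => by
    have : Continuous fun x : Cube d => θ.β j * ((x j : Set.Icc (-1 : ℝ) 1) : ℝ) := by fun_prop
    exact this
  | l + 1, j => by
    have h := continuous_nodeVal θ l
    simp only [nodeVal]
    fun_prop

theorem continuous_eval (θ : SierNet d) : Continuous θ.eval := by
  have h := continuous_nodeVal θ
  unfold eval skipVal
  fun_prop

/-- The network that computes the zero function. -/
def zeroNet (d : ℕ) : SierNet d where
  numHidden := 0
  width _ := 0
  β _ := 0
  W _ := 0
  b _ := 0
  wSkip _ := 0
  bSkip _ := 0
  α _ := 1
  sum_abs_α_pos := by simp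

theorem zeroNet_eval (x : Cube d) : (zeroNet d).eval x = 0 := by
  simp [eval, skipVal, zeroNet]

theorem zeroNet_mem {L : ℕ} {B₀ B₁ : ℝ} (hL : 2 ≤ L) (h0 : 0 ≤ B₀) (h1 : 0 ≤ B₁) :
    zeroNet d ∈ sierParams d L B₀ B₁ := by
  refine ⟨hL, fun x => by simpa [zeroNet_eval] using h0, ?_⟩
  simpa [totalVariation, zeroNet] using h1

section Append

variable {m k m' k' : ℕ} {z : Fin (m + k) → ℝ} {z₁ : Fin m → ℝ} {z₂ : Fin k → ℝ} (φ : ℝ → ℝ)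

/-- The map `φ` lets one computation serve both purposes: the identity or a multiple of it for node
values, an absolute value for path weights. -/
theorem sum_mul_append (h₁ : ∀ i, z (Fin.castAdd k i) = z₁ i)
    (h₂ : ∀ i, z (Fin.natAdd m i) = z₂ i) (w₁ : Fin m → ℝ) (w₂ : Fin k → ℝ) :
    ∑ i, z i * φ (Fin.append w₁ w₂ i) = ∑ i, z₁ i * φ (w₁ i) + ∑ i, z₂ i * φ (w₂ i) := by
  simp [Fin.sum_univ_add, h₁, h₂]

theorem blockDiagonal_left (hφ : φ 0 = 0) (h₁ : ∀ i, z (Fin.castAdd k i) = z₁ i)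
    (w₁ : Fin m → Fin m' → ℝ) (w₂ : Fin k → Fin k' → ℝ) (b₁ : Fin m' → ℝ) (b₂ : Fin k' → ℝ)
    (j : Fin m') :
    ∑ i, z i * φ (Fin.append (fun j₁ => Fin.append (fun i₁ => w₁ i₁ j₁) (fun _ => 0) i)
      (fun j₂ => Fin.append (fun _ => 0) (fun i₂ => w₂ i₂ j₂) i) (Fin.castAdd k' j)) +
      φ (Fin.append b₁ b₂ (Fin.castAdd k' j)) = ∑ i, z₁ i * φ (w₁ i j) + φ (b₁ j) := by
  simp [Fin.sum_univ_add, h₁, hφ]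

theorem blockDiagonal_right (hφ : φ 0 = 0) (h₂ : ∀ i, z (Fin.natAdd m i) = z₂ i)
    (w₁ : Fin m → Fin m' → ℝ) (w₂ : Fin k → Fin k' → ℝ) (b₁ : Fin m' → ℝ) (b₂ : Fin k' → ℝ)
    (j : Fin k') :
    ∑ i, z i * φ (Fin.append (fun j₁ => Fin.append (fun i₁ => w₁ i₁ j₁) (fun _ => 0) i)
      (fun j₂ => Fin.append (fun _ => 0) (fun i₂ => w₂ i₂ j₂) i) (Fin.natAdd m' j)) +
      φ (Fin.append b₁ b₂ (Fin.natAdd m' j)) = ∑ i, z₂ i * φ (w₂ i j) + φ (b₂ j) := by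
  simp [Fin.sum_univ_add, h₂, hφ]

theorem sum_mul_append_left {ι : Type*} [Fintype ι] (y : ι → ℝ) (w₁ : ι → Fin m → ℝ)
    (w₂ : ι → Fin k → ℝ) (b₁ : Fin m → ℝ) (b₂ : Fin k → ℝ) (j : Fin m) :
    ∑ i, y i * φ (Fin.append (w₁ i) (w₂ i) (Fin.castAdd k j)) +
      φ (Fin.append b₁ b₂ (Fin.castAdd k j)) = ∑ i, y i * φ (w₁ i j) + φ (b₁ j) := by
  simp

theorem sum_mul_append_right {ι : Type*} [Fintype ι] (y : ι → ℝ) (w₁ : ι → Fin m → ℝ)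
    (w₂ : ι → Fin k → ℝ) (b₁ : Fin m → ℝ) (b₂ : Fin k → ℝ) (j : Fin k) :
    ∑ i, y i * φ (Fin.append (w₁ i) (w₂ i) (Fin.natAdd m j)) +
      φ (Fin.append b₁ b₂ (Fin.natAdd m j)) = ∑ i, y i * φ (w₂ i j) + φ (b₂ j) := by
  simp

end Append

section Combine

variable (θ₁ θ₂ : SierNet d) (c₁ c₂ : ℝ)

/-- Weights of two networks side by side, with the input scalings absorbed in the first layer. -/
def combineW : ∀ l : ℕ, Matrix (Fin (layerNodes d (fun k => θ₁.width k + θ₂.width k) l))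
    (Fin (layerNodes d (fun k => θ₁.width k + θ₂.width k) (l + 1))) ℝ
  | 0 => fun i j => Fin.append (m := θ₁.width 0) (n := θ₂.width 0) (fun j₁ => θ₁.β i * θ₁.W 0 i j₁)
      (fun j₂ => θ₂.β i * θ₂.W 0 i j₂) j
  | l + 1 => fun i j => Fin.append (m := θ₁.width (l + 1)) (n := θ₂.width (l + 1))
      (fun j₁ => Fin.append (m := θ₁.width l) (n := θ₂.width l)
        (fun i₁ => θ₁.W (l + 1) i₁ j₁) (fun _ => 0) i)
      (fun j₂ => Fin.append (m := θ₁.width l) (n := θ₂.width l)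
        (fun _ => 0) (fun i₂ => θ₂.W (l + 1) i₂ j₂) i) j

/-- Coefficient of the skip-connection node of layer `l` in the output of a network. -/
noncomputable def outputWeight (θ : SierNet d) (l : ℕ) : ℝ :=
  if l ∈ Finset.range (θ.numHidden + 1) then θ.skipWeight l else 0

/-- Skip-connection weights of the combination of two networks. -/
noncomputable def combineSkip (N : ℝ) :
    ∀ l : ℕ, Fin (layerNodes d (fun k => θ₁.width k + θ₂.width k) l) → ℝ
  | 0 => fun i => N * (c₁ * θ₁.outputWeight 0 * (θ₁.β i * θ₁.wSkip 0 i) +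
      c₂ * θ₂.outputWeight 0 * (θ₂.β i * θ₂.wSkip 0 i))
  | l + 1 => fun i => N * Fin.append (m := θ₁.width l) (n := θ₂.width l)
      (fun i₁ => c₁ * θ₁.outputWeight (l + 1) * θ₁.wSkip (l + 1) i₁)
      (fun i₂ => c₂ * θ₂.outputWeight (l + 1) * θ₂.wSkip (l + 1) i₂) i

/-- The network that computes a linear combination of two networks. -/
noncomputable def combine : SierNet d where
  numHidden := max θ₁.numHidden θ₂.numHidden
  width k := θ₁.width k + θ₂.width k
  β _ := 1
  W := combineW θ₁ θ₂
  b l j := Fin.append (m := θ₁.width l) (n := θ₂.width l) (θ₁.b l) (θ₂.b l) j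
  wSkip := combineSkip θ₁ θ₂ c₁ c₂ (max θ₁.numHidden θ₂.numHidden + 1 : ℕ)
  bSkip l := (max θ₁.numHidden θ₂.numHidden + 1 : ℕ) *
    (c₁ * θ₁.outputWeight l * θ₁.bSkip l + c₂ * θ₂.outputWeight l * θ₂.bSkip l)
  α _ := 1
  sum_abs_α_pos := by simp; positivity

/-- The cross blocks are zero, so the two networks do not interact beyond the shared inputs. The
statement also covers layers beyond the depth of one network, which `outputWeight` later cancels. -/
theorem combine_nodeVal_succ (x : Cube d) (l : ℕ) :
    (∀ j, (combine θ₁ θ₂ c₁ c₂).nodeVal x (l + 1) (Fin.castAdd (θ₂.width l) j) =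
      θ₁.nodeVal x (l + 1) j) ∧
    ∀ j, (combine θ₁ θ₂ c₁ c₂).nodeVal x (l + 1) (Fin.natAdd (θ₁.width l) j) =
      θ₂.nodeVal x (l + 1) j := by
  induction l with
  | zero =>
    have e : ∀ (β w : Fin d → ℝ), ∑ i, 1 * (x i : ℝ) * (β i * w i) = ∑ i, β i * (x i : ℝ) * w i :=
      fun β w => Finset.sum_congr rfl fun i _ => by ring
    constructor <;> intro j
    · refine congrArg (max · 0) ((sum_mul_append_left id (fun i : Fin d => 1 * (x i : ℝ))
        (fun i j₁ => θ₁.β i * θ₁.W 0 i j₁) (fun i j₂ => θ₂.β i * θ₂.W 0 i j₂)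
        (θ₁.b 0) (θ₂.b 0) j).trans ?_)
      exact congrArg (· + θ₁.b 0 j) (e θ₁.β fun i => θ₁.W 0 i j)
    · refine congrArg (max · 0) ((sum_mul_append_right id (fun i : Fin d => 1 * (x i : ℝ))
        (fun i j₁ => θ₁.β i * θ₁.W 0 i j₁) (fun i j₂ => θ₂.β i * θ₂.W 0 i j₂)
        (θ₁.b 0) (θ₂.b 0) j).trans ?_)
      exact congrArg (· + θ₂.b 0 j) (e θ₂.β fun i => θ₂.W 0 i j)
  | succ l ih =>
    exact ⟨fun j => congrArg (max · 0) (blockDiagonal_left id rfl ih.1 (θ₁.W (l + 1))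
        (θ₂.W (l + 1)) (θ₁.b (l + 1)) (θ₂.b (l + 1)) j),
      fun j => congrArg (max · 0) (blockDiagonal_right id rfl ih.2 (θ₁.W (l + 1))
        (θ₂.W (l + 1)) (θ₁.b (l + 1)) (θ₂.b (l + 1)) j)⟩

theorem combine_pathWeight_succ (l : ℕ) :
    (∀ j, (combine θ₁ θ₂ c₁ c₂).pathWeight (l + 1) (Fin.castAdd (θ₂.width l) j) =
      θ₁.pathWeight (l + 1) j) ∧
    ∀ j, (combine θ₁ θ₂ c₁ c₂).pathWeight (l + 1) (Fin.natAdd (θ₁.width l) j) =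
      θ₂.pathWeight (l + 1) j := by
  induction l with
  | zero =>
    have e : ∀ (β w : Fin d → ℝ), ∑ i, |(1 : ℝ)| * |β i * w i| = ∑ i, |β i| * |w i| :=
      fun β w => Finset.sum_congr rfl fun i _ => by rw [abs_one, one_mul, abs_mul]
    constructor <;> intro j
    · refine (sum_mul_append_left abs (fun i : Fin d => |(1 : ℝ)|)
        (fun i j₁ => θ₁.β i * θ₁.W 0 i j₁) (fun i j₂ => θ₂.β i * θ₂.W 0 i j₂)
        (θ₁.b 0) (θ₂.b 0) j).trans ?_
      exact congrArg (· + |θ₁.b 0 j|) (e θ₁.β fun i => θ₁.W 0 i j)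
    · refine (sum_mul_append_right abs (fun i : Fin d => |(1 : ℝ)|)
        (fun i j₁ => θ₁.β i * θ₁.W 0 i j₁) (fun i j₂ => θ₂.β i * θ₂.W 0 i j₂)
        (θ₁.b 0) (θ₂.b 0) j).trans ?_
      exact congrArg (· + |θ₂.b 0 j|) (e θ₂.β fun i => θ₂.W 0 i j)
  | succ l ih =>
    exact ⟨blockDiagonal_left abs abs_zero ih.1 (θ₁.W (l + 1)) (θ₂.W (l + 1)) (θ₁.b (l + 1))
        (θ₂.b (l + 1)),
      blockDiagonal_right abs abs_zero ih.2 (θ₁.W (l + 1)) (θ₂.W (l + 1)) (θ₁.b (l + 1))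
        (θ₂.b (l + 1))⟩

theorem combine_skipVal (x : Cube d) (l : ℕ) :
    (combine θ₁ θ₂ c₁ c₂).skipVal x l = (max θ₁.numHidden θ₂.numHidden + 1 : ℕ) *
      (c₁ * (θ₁.outputWeight l * θ₁.skipVal x l) + c₂ * (θ₂.outputWeight l * θ₂.skipVal x l)) := by
  set N : ℝ := ((max θ₁.numHidden θ₂.numHidden + 1 : ℕ) : ℝ)
  cases l with
  | zero =>
    change ∑ i : Fin d, 1 * (x i : ℝ) * (N * (c₁ * θ₁.outputWeight 0 * (θ₁.β i * θ₁.wSkip 0 i) +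
        c₂ * θ₂.outputWeight 0 * (θ₂.β i * θ₂.wSkip 0 i))) +
      N * (c₁ * θ₁.outputWeight 0 * θ₁.bSkip 0 + c₂ * θ₂.outputWeight 0 * θ₂.bSkip 0) =
      N * (c₁ * (θ₁.outputWeight 0 * (∑ i : Fin d, θ₁.β i * (x i : ℝ) * θ₁.wSkip 0 i +
          θ₁.bSkip 0)) +
        c₂ * (θ₂.outputWeight 0 * (∑ i : Fin d, θ₂.β i * (x i : ℝ) * θ₂.wSkip 0 i + θ₂.bSkip 0)))
    simp only [mul_add, Finset.mul_sum, Finset.sum_add_distrib]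
    have e : ∀ (c o : ℝ) (β w : Fin d → ℝ), ∑ i, 1 * (x i : ℝ) * (N * (c * o * (β i * w i))) =
        ∑ i, N * (c * (o * (β i * (x i : ℝ) * w i))) := fun c o β w =>
      Finset.sum_congr rfl fun i _ => by ring
    rw [e c₁ (θ₁.outputWeight 0) θ₁.β (θ₁.wSkip 0), e c₂ (θ₂.outputWeight 0) θ₂.β (θ₂.wSkip 0)]
    ring
  | succ l =>
    have e : ∀ {m k : ℕ} (z₁ w₁ : Fin m → ℝ) (z₂ w₂ : Fin k → ℝ) (o₁ o₂ b₁ b₂ : ℝ),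
        ∑ i, z₁ i * (N * (c₁ * o₁ * w₁ i)) + ∑ i, z₂ i * (N * (c₂ * o₂ * w₂ i)) +
          N * (c₁ * o₁ * b₁ + c₂ * o₂ * b₂) =
        N * (c₁ * (o₁ * (∑ i, z₁ i * w₁ i + b₁)) + c₂ * (o₂ * (∑ i, z₂ i * w₂ i + b₂))) := by
      intro m k z₁ w₁ z₂ w₂ o₁ o₂ b₁ b₂
      have e : ∀ {m : ℕ} (c o : ℝ) (z w : Fin m → ℝ), ∑ i, z i * (N * (c * o * w i)) =
          N * (c * (o * ∑ i, z i * w i)) := by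
        intro m c o z w
        simp only [Finset.mul_sum]
        exact Finset.sum_congr rfl fun i _ => by ring
      rw [e, e]
      ring
    exact (congrArg (· + _) (sum_mul_append (N * ·) (combine_nodeVal_succ θ₁ θ₂ c₁ c₂ x l).1
      (combine_nodeVal_succ θ₁ θ₂ c₁ c₂ x l).2
      (fun i₁ => c₁ * θ₁.outputWeight (l + 1) * θ₁.wSkip (l + 1) i₁)
      (fun i₂ => c₂ * θ₂.outputWeight (l + 1) * θ₂.wSkip (l + 1) i₂))).trans
      (e (fun i => θ₁.nodeVal x (l + 1) i) (θ₁.wSkip (l + 1)) (fun i => θ₂.nodeVal x (l + 1) i)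
        (θ₂.wSkip (l + 1)) _ _ _ _)

/-- Path weight of the skip-connection node of layer `l`. -/
noncomputable def skipPathWeight (θ : SierNet d) (l : ℕ) : ℝ :=
  ∑ i, θ.pathWeight l i * |θ.wSkip l i| + |θ.bSkip l|

theorem outputWeight_nonneg (θ : SierNet d) (l : ℕ) : 0 ≤ θ.outputWeight l := by
  unfold outputWeight
  split_ifs
  exacts [θ.skipWeight_nonneg l, le_rfl]

/-- The triangle inequality is needed at the edges that both networks share, those from the inputs
and from the constant unit; elsewhere path weights simply add. -/
theorem combine_skipPathWeight_le {c₁ c₂ : ℝ} (h₁ : 0 ≤ c₁) (h₂ : 0 ≤ c₂) (l : ℕ) :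
    (combine θ₁ θ₂ c₁ c₂).skipPathWeight l ≤ (max θ₁.numHidden θ₂.numHidden + 1 : ℕ) *
      (c₁ * (θ₁.outputWeight l * θ₁.skipPathWeight l) +
        c₂ * (θ₂.outputWeight l * θ₂.skipPathWeight l)) := by
  have hN : (0 : ℝ) ≤ ((max θ₁.numHidden θ₂.numHidden + 1 : ℕ) : ℝ) := Nat.cast_nonneg _
  set N : ℝ := ((max θ₁.numHidden θ₂.numHidden + 1 : ℕ) : ℝ)
  have key : ∀ y z : ℝ, |N * (c₁ * θ₁.outputWeight l * y + c₂ * θ₂.outputWeight l * z)| ≤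
      N * (c₁ * θ₁.outputWeight l * |y| + c₂ * θ₂.outputWeight l * |z|) := by
    intro y z
    have a₁ := mul_nonneg h₁ (θ₁.outputWeight_nonneg l)
    have a₂ := mul_nonneg h₂ (θ₂.outputWeight_nonneg l)
    rw [abs_mul, abs_of_nonneg hN]
    refine mul_le_mul_of_nonneg_left ((abs_add_le _ _).trans (le_of_eq ?_)) hN
    rw [abs_mul _ y, abs_mul _ z, abs_of_nonneg a₁, abs_of_nonneg a₂]
  have hb := key (θ₁.bSkip l) (θ₂.bSkip l)
  cases l with
  | zero =>
    change ∑ i : Fin d, |(1 : ℝ)| * |N * (c₁ * θ₁.outputWeight 0 * (θ₁.β i * θ₁.wSkip 0 i) +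
        c₂ * θ₂.outputWeight 0 * (θ₂.β i * θ₂.wSkip 0 i))| +
      |N * (c₁ * θ₁.outputWeight 0 * θ₁.bSkip 0 + c₂ * θ₂.outputWeight 0 * θ₂.bSkip 0)| ≤
      N * (c₁ * (θ₁.outputWeight 0 * (∑ i : Fin d, |θ₁.β i| * |θ₁.wSkip 0 i| + |θ₁.bSkip 0|)) +
        c₂ * (θ₂.outputWeight 0 * (∑ i : Fin d, |θ₂.β i| * |θ₂.wSkip 0 i| + |θ₂.bSkip 0|)))
    have hs : ∑ i : Fin d, |(1 : ℝ)| * |N * (c₁ * θ₁.outputWeight 0 * (θ₁.β i * θ₁.wSkip 0 i) +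
        c₂ * θ₂.outputWeight 0 * (θ₂.β i * θ₂.wSkip 0 i))| ≤
        ∑ i : Fin d, N * (c₁ * θ₁.outputWeight 0 * (|θ₁.β i| * |θ₁.wSkip 0 i|) +
          c₂ * θ₂.outputWeight 0 * (|θ₂.β i| * |θ₂.wSkip 0 i|)) := by
      refine Finset.sum_le_sum fun i _ => ?_
      rw [abs_one, one_mul, ← abs_mul, ← abs_mul]
      exact key _ _
    refine (add_le_add hs hb).trans (le_of_eq ?_)
    rw [← Finset.mul_sum, Finset.sum_add_distrib, ← Finset.mul_sum, ← Finset.mul_sum]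
    ring
  | succ l =>
    have e : ∀ {m k : ℕ} (z₁ w₁ : Fin m → ℝ) (z₂ w₂ : Fin k → ℝ),
        ∑ i, z₁ i * |N * (c₁ * θ₁.outputWeight (l + 1) * w₁ i)| +
          ∑ i, z₂ i * |N * (c₂ * θ₂.outputWeight (l + 1) * w₂ i)| +
          |N * (c₁ * θ₁.outputWeight (l + 1) * θ₁.bSkip (l + 1) +
            c₂ * θ₂.outputWeight (l + 1) * θ₂.bSkip (l + 1))| ≤
        N * (c₁ * (θ₁.outputWeight (l + 1) * (∑ i, z₁ i * |w₁ i| + |θ₁.bSkip (l + 1)|)) +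
          c₂ * (θ₂.outputWeight (l + 1) * (∑ i, z₂ i * |w₂ i| + |θ₂.bSkip (l + 1)|))) := by
      intro m k z₁ w₁ z₂ w₂
      have e : ∀ {m : ℕ} {c o : ℝ} (_ : 0 ≤ c) (_ : 0 ≤ o) (z w : Fin m → ℝ),
          ∑ i, z i * |N * (c * o * w i)| = N * (c * (o * ∑ i, z i * |w i|)) := by
        intro m c o hc ho z w
        simp only [abs_mul, abs_of_nonneg hN, abs_of_nonneg hc, abs_of_nonneg ho, Finset.mul_sum]
        exact Finset.sum_congr rfl fun i _ => by ring
      rw [e h₁ (θ₁.outputWeight_nonneg _), e h₂ (θ₂.outputWeight_nonneg _)]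
      refine (add_le_add le_rfl hb).trans (le_of_eq ?_)
      ring
    exact (congrArg (· + _) (sum_mul_append (fun y => |N * y|)
      (combine_pathWeight_succ θ₁ θ₂ c₁ c₂ l).1 (combine_pathWeight_succ θ₁ θ₂ c₁ c₂ l).2
      (fun i₁ => c₁ * θ₁.outputWeight (l + 1) * θ₁.wSkip (l + 1) i₁)
      (fun i₂ => c₂ * θ₂.outputWeight (l + 1) * θ₂.wSkip (l + 1) i₂))).trans_le
      (e (fun i => θ₁.pathWeight (l + 1) i) (θ₁.wSkip (l + 1)) (fun i => θ₂.pathWeight (l + 1) i)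
        (θ₂.wSkip (l + 1)))

theorem sum_outputWeight_mul (θ : SierNet d) {H : ℕ} (hH : θ.numHidden ≤ H) (y : ℕ → ℝ) :
    ∑ l ∈ Finset.range (H + 1), θ.outputWeight l * y l =
      ∑ l ∈ Finset.range (θ.numHidden + 1), θ.skipWeight l * y l := by
  have hsub : Finset.range (θ.numHidden + 1) ⊆ Finset.range (H + 1) :=
    Finset.range_subset_range.2 (by omega)
  rw [← Finset.sum_subset hsub fun l _ hl => by simp only [outputWeight, if_neg hl, zero_mul]]
  exact Finset.sum_congr rfl fun l hl => by simp only [outputWeight, if_pos hl]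

/-- All skip factors of the combination equal one, so each normalized weight is the inverse of the
number of skip nodes; this explains the factor built into `combineSkip` and the skip biases. -/
theorem combine_skipWeight_mul (l : ℕ) (y : ℝ) : (combine θ₁ θ₂ c₁ c₂).skipWeight l *
    ((max θ₁.numHidden θ₂.numHidden + 1 : ℕ) * y) = y := by
  have h : ((max θ₁.numHidden θ₂.numHidden + 1 : ℕ) : ℝ) ≠ 0 := Nat.cast_ne_zero.2 (by omega)
  have e : (combine θ₁ θ₂ c₁ c₂).skipWeight l =
      1 / ((max θ₁.numHidden θ₂.numHidden + 1 : ℕ) : ℝ) := by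
    simp [skipWeight, combine]
  rw [e]
  field_simp

theorem combine_eval (x : Cube d) :
    (combine θ₁ θ₂ c₁ c₂).eval x = c₁ * θ₁.eval x + c₂ * θ₂.eval x := by
  change ∑ l ∈ Finset.range (max θ₁.numHidden θ₂.numHidden + 1), _ = _
  simp only [combine_skipVal, combine_skipWeight_mul, Finset.sum_add_distrib, ← Finset.mul_sum]
  rw [sum_outputWeight_mul θ₁ (le_max_left _ _), sum_outputWeight_mul θ₂ (le_max_right _ _)]
  rfl

theorem combine_totalVariation_le {c₁ c₂ : ℝ} (h₁ : 0 ≤ c₁) (h₂ : 0 ≤ c₂) :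
    (combine θ₁ θ₂ c₁ c₂).totalVariation ≤ c₁ * θ₁.totalVariation + c₂ * θ₂.totalVariation := by
  calc (combine θ₁ θ₂ c₁ c₂).totalVariation
      = ∑ l ∈ Finset.range (max θ₁.numHidden θ₂.numHidden + 1),
        (combine θ₁ θ₂ c₁ c₂).skipWeight l * (combine θ₁ θ₂ c₁ c₂).skipPathWeight l := rfl
    _ ≤ ∑ l ∈ Finset.range (max θ₁.numHidden θ₂.numHidden + 1),
        (c₁ * (θ₁.outputWeight l * θ₁.skipPathWeight l) +
          c₂ * (θ₂.outputWeight l * θ₂.skipPathWeight l)) := by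
        refine Finset.sum_le_sum fun l _ => ?_
        rw [← combine_skipWeight_mul θ₁ θ₂ c₁ c₂ l (_ + _)]
        exact mul_le_mul_of_nonneg_left (combine_skipPathWeight_le θ₁ θ₂ h₁ h₂ l)
          (skipWeight_nonneg _ l)
    _ = _ := by
        simp only [Finset.sum_add_distrib, ← Finset.mul_sum]
        rw [sum_outputWeight_mul θ₁ (le_max_left _ _), sum_outputWeight_mul θ₂ (le_max_right _ _)]
        rfl

end Combine

/-- The functions computed by the networks of `sierParams` form a convex class. -/
theorem exists_eval_eq_convexCombination {L : ℕ} {B₀ B₁ : ℝ} {θ₁ θ₂ : SierNet d}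
    (h₁ : θ₁ ∈ sierParams d L B₀ B₁) (h₂ : θ₂ ∈ sierParams d L B₀ B₁) {t : ℝ} (ht0 : 0 ≤ t)
    (ht1 : t ≤ 1) :
    ∃ θ ∈ sierParams d L B₀ B₁, ∀ x, θ.eval x = (1 - t) * θ₁.eval x + t * θ₂.eval x := by
  refine ⟨combine θ₁ θ₂ (1 - t) t, ⟨?_, fun x => ?_, ?_⟩, combine_eval θ₁ θ₂ (1 - t) t⟩
  · have a₁ := h₁.1
    have a₂ := h₂.1
    simp only [numLayers, combine] at *
    omega
  · rw [combine_eval]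
    have a₁ := h₁.2.1 x
    have a₂ := h₂.2.1 x
    rw [abs_le] at *
    constructor <;> nlinarith
  · refine (combine_totalVariation_le θ₁ θ₂ (sub_nonneg.2 ht1) ht0).trans ?_
    nlinarith [h₁.2.2, h₂.2.2]

end SierNet

/-! ### Localization: noise and design in one exponential bound. -/

/-- A Gaussian process over vectors that can be shrunk towards zero rarely exceeds the squared
norms of the vectors. -/
theorem measure_gaussian_ge_sq_le {n : ℕ} {ι : Type*} [Finite ι] [Nonempty ι] (v : NNReal)
    (g : ι → Fin n → ℝ) {M Q H lam : ℝ} (hM0 : 0 ≤ M) (hH : 0 ≤ H) (hl : 0 ≤ lam)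
    (hlv : 8 * lam * v ≤ 1)
    (hM : ∀ t : ι → ℝ, (∀ i, 0 ≤ t i ∧ t i ≤ 1) →
      ∫ x, maxLinear (fun i k => t i * g i k) x ∂(Measure.pi fun _ => gaussianReal 0 v) ≤ M)
    (hQ : ∀ i, Q ≤ ∑ k, g i k ^ 2) :
    (Measure.pi fun _ => gaussianReal 0 v).real
      {x : Fin n → ℝ | ∃ i, ∑ k, g i k ^ 2 - H < ∑ k, g i k * x k} ≤
      Real.exp (-lam * (Q - 2 * (M + H))) := by
  -- For `Q ≤ 0` the claimed bound is at least one. This matters because `Q` will be random and may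
  -- be negative.
  rcases le_or_gt Q 0 with hQ0 | hQ0
  · refine measureReal_le_one.trans (Real.one_le_exp ?_)
    nlinarith
  have hS : ∀ i, 0 < ∑ k, g i k ^ 2 := fun i => hQ0.trans_le (hQ i)
  -- Shrinks every vector to squared norm exactly `Q`, so that the variance proxy is `Q` however
  -- large the original vector is. As `t ≤ 1`, one has `t * ∑ g² ≥ t² * ∑ g² = Q`.
  let t : ι → ℝ := fun i => Real.sqrt (Q / ∑ k, g i k ^ 2)
  have ht : ∀ i, 0 ≤ t i ∧ t i ≤ 1 := fun i =>
    ⟨Real.sqrt_nonneg _, Real.sqrt_le_one.2 ((div_le_one (hS i)).2 (hQ i))⟩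
  have ht2 : ∀ i, t i ^ 2 * ∑ k, g i k ^ 2 = Q := fun i => by
    rw [Real.sq_sqrt (div_nonneg hQ0.le (hS i).le), div_mul_cancel₀ _ (hS i).ne']
  have hsub : {x : Fin n → ℝ | ∃ i, ∑ k, g i k ^ 2 - H < ∑ k, g i k * x k} ⊆
      {x | Q - H ≤ maxLinear (fun i k => t i * g i k) x} := by
    rintro x ⟨i, hi⟩
    refine le_trans ?_ (le_maxLinear (fun i k => t i * g i k) i x)
    have e : ∑ k, t i * g i k * x k = t i * ∑ k, g i k * x k := by
      rw [Finset.mul_sum]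
      exact Finset.sum_congr rfl fun k _ => by ring
    rw [e]
    have h1 := mul_le_mul_of_nonneg_left hi.le (ht i).1
    have h2 : Q ≤ t i * ∑ k, g i k ^ 2 := by
      rw [← ht2 i]
      refine mul_le_mul_of_nonneg_right ?_ (hS i).le
      nlinarith [ht i]
    have h3 : t i * H ≤ H := mul_le_of_le_one_left hH (ht i).2
    linarith
  -- At exponent `2 * lam` the variance term is `8 * lam² * v * Q ≤ lam * Q`, half of the gain `2 *
  -- lam * Q`.
  refine (measureReal_mono hsub).trans ((measure_le_maxLinear_le v (fun i k => t i * g i k)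
    (r2 := Q) (fun i => ?_) (t := 2 * lam) (by positivity) (Q - H)).trans
    (Real.exp_le_exp.2 ?_))
  · rw [← ht2 i, Finset.mul_sum]
    exact (Finset.sum_congr rfl fun k _ => by ring).le
  · have h1 := mul_le_mul_of_nonneg_left (hM t ht) hl
    have h2 : lam * Q * (8 * lam * v) ≤ lam * Q * 1 :=
      mul_le_mul_of_nonneg_left hlv (by positivity)
    nlinarith

/-- Probability that least squares over a finite star-shaped class prefers a function of large
second moment to the zero function. -/
theorem measure_prod_gaussian_ge_sq_le {X : Type*} [MeasurableSpace X] (μ : Measure X)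
    [IsProbabilityMeasure μ] {n : ℕ} {ι : Type*} [Finite ι] [Nonempty ι] (v : NNReal)
    {g : ι → X → ℝ} (hg : ∀ i, Measurable (g i)) {B κ M C H lam : ℝ}
    (hB : ∀ i x, |g i x| ≤ 2 * B) (hM0 : 0 ≤ M) (hH : 0 ≤ H) (hl : 0 ≤ lam)
    (hlv : 8 * lam * v ≤ 1) (hκ : ∀ i, κ ≤ ∫ x, g i x ^ 2 ∂μ)
    (hM : ∀ (x : Fin n → X) (t : ι → ℝ), (∀ i, 0 ≤ t i ∧ t i ≤ 1) →
      ∫ y, maxLinear (fun i k => t i * g i (x k)) y ∂(Measure.pi fun _ => gaussianReal 0 v) ≤ M)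
    (hC : ∀ x : Fin n → X,
      ∑ r : Fin n → Bool, ⨆ i, ∑ k, boolSign (r k) * g i (x k) ^ 2 ≤ 2 ^ n * C) :
    ((Measure.pi fun _ => μ).prod (Measure.pi fun _ => gaussianReal 0 v))
      {p : (Fin n → X) × (Fin n → ℝ) |
        ∃ i, ∑ k, g i (p.1 k) ^ 2 - H < ∑ k, g i (p.1 k) * p.2 k} ≤
      ENNReal.ofReal (Real.exp (-lam * (n * κ - 2 * (M + H) - 2 * C) +
        n * (2 * lam ^ 2 * B ^ 4))) := by
  set π : Measure (Fin n → X) := Measure.pi fun _ => μ with hπ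
  set Γ : Measure (Fin n → ℝ) := Measure.pi fun _ => gaussianReal 0 v with hΓ
  obtain ⟨i₀⟩ := ‹Nonempty ι›
  obtain ⟨x₀⟩ : Nonempty X := nonempty_of_isProbabilityMeasure μ
  have : Nonempty ι := ⟨i₀⟩
  have hB0 : 0 ≤ B := by linarith [abs_nonneg (g i₀ x₀), hB i₀ x₀]
  have hsq : ∀ i x, g i x ^ 2 ≤ 4 * B ^ 2 := fun i x => by
    have := pow_le_pow_left₀ (abs_nonneg _) (hB i x) 2
    rw [sq_abs] at this
    linarith
  let A : (Fin n → X) → ℝ := fun x => ⨆ i, ∑ k, (∫ y, g i y ^ 2 ∂μ - g i (x k) ^ 2)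
  have hAm : Measurable A := Measurable.iSup fun i => by fun_prop
  have hmean : ∀ i, 0 ≤ ∫ y, g i y ^ 2 ∂μ ∧ ∫ y, g i y ^ 2 ∂μ ≤ 4 * B ^ 2 := by
    intro i
    refine ⟨integral_nonneg fun _ => sq_nonneg _, ?_⟩
    have := norm_integral_le_of_norm_le_const (μ := μ) (f := fun y => g i y ^ 2) (C := 4 * B ^ 2)
      (Filter.Eventually.of_forall fun y => by
        rw [Real.norm_eq_abs, abs_of_nonneg (sq_nonneg _)]; exact hsq i y)
    exact (le_abs_self _).trans (by simpa using this)
  have hAb : ∀ x, |A x| ≤ n * (4 * B ^ 2) := by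
    refine fun x => abs_iSup_le_of_abs_le fun i => (Finset.abs_sum_le_sum_abs _ _).trans
      ((Finset.sum_le_sum fun k _ => (?_ : _ ≤ 4 * B ^ 2)).trans (by simp))
    have h1 := hmean i
    have h2 := hsq i (x k)
    have h3 := sq_nonneg (g i (x k))
    rw [abs_le]
    constructor <;> linarith
  have hAd1 : ∀ x k y, A (Function.update x k y) ≤ A x + 4 * B ^ 2 := by
    intro x k y
    refine ciSup_le fun i => ?_
    have h1 := le_ciSup (Finite.bddAbove_range fun i =>
      ∑ k, (∫ y, g i y ^ 2 ∂μ - g i (x k) ^ 2)) i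
    have h2 : ∑ j, (∫ y, g i y ^ 2 ∂μ - g i (Function.update x k y j) ^ 2) ≤
        ∑ j, ((∫ y, g i y ^ 2 ∂μ - g i (x j) ^ 2) + if j = k then 4 * B ^ 2 else 0) := by
      refine Finset.sum_le_sum fun j _ => ?_
      split_ifs with hj
      · linarith [hsq i (x j), sq_nonneg (g i (Function.update x k y j))]
      · rw [Function.update_of_ne hj, add_zero]
    rw [Finset.sum_add_distrib, Finset.sum_ite_eq' Finset.univ k, if_pos (Finset.mem_univ _)] at h2
    exact h2.trans (add_le_add h1 le_rfl)
  have hAd : ∀ x k y, |A (Function.update x k y) - A x| ≤ 4 * B ^ 2 := by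
    intro x k y
    have h1 := hAd1 x k y
    have h2 := hAd1 (Function.update x k y) k (x k)
    rw [Function.update_idem, Function.update_eq_self] at h2
    rw [abs_le]
    constructor <;> linarith
  have hEA : ∫ x, A x ∂π ≤ 2 * C :=
    integral_iSup_sub_le_of_sum_signs μ (h := fun i x => g i x ^ 2) (fun i => (hg i).pow_const 2)
      (M := 4 * B ^ 2) (fun i x => by rw [abs_of_nonneg (sq_nonneg _)]; exact hsq i x) hC
  have hmeas : MeasurableSet {p : (Fin n → X) × (Fin n → ℝ) |
      ∃ i, ∑ k, g i (p.1 k) ^ 2 - H < ∑ k, g i (p.1 k) * p.2 k} := by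
    rw [Set.ofPred_exists]
    exact MeasurableSet.iUnion fun i => measurableSet_lt (by fun_prop) (by fun_prop)
  have hsec : ∀ x : Fin n → X, Γ {y | ∃ i, ∑ k, g i (x k) ^ 2 - H < ∑ k, g i (x k) * y k} ≤
      ENNReal.ofReal (Real.exp (-lam * (n * κ - 2 * (M + H))) * Real.exp (lam * A x)) := by
    intro x
    -- The lower bound on empirical squared norms is the population bound minus the uniform
    -- deviation `A x`, which enters the exponent linearly.
    have h := measure_gaussian_ge_sq_le v (fun i k => g i (x k)) (Q := n * κ - A x) hM0 hH hl hlv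
      (hM x) fun i => by
        have h1 := le_ciSup (Finite.bddAbove_range fun i =>
          ∑ k, (∫ y, g i y ^ 2 ∂μ - g i (x k) ^ 2)) i
        have h2 : ∑ k, (∫ y, g i y ^ 2 ∂μ - g i (x k) ^ 2) =
            n * ∫ y, g i y ^ 2 ∂μ - ∑ k, g i (x k) ^ 2 := by
          rw [Finset.sum_sub_distrib]
          simp
        have h3 : (n : ℝ) * κ ≤ n * ∫ y, g i y ^ 2 ∂μ :=
          mul_le_mul_of_nonneg_left (hκ i) (Nat.cast_nonneg n)
        simp only [A]
        linarith
    rw [← ENNReal.ofReal_toReal (measure_ne_top Γ _)]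
    refine ENNReal.ofReal_le_ofReal (h.trans (le_of_eq ?_))
    rw [← Real.exp_add]
    ring_nf
  have hint : Integrable (fun x => Real.exp (lam * A x)) π := by
    refine integrable_of_abs_le _ (hAm.const_mul lam).exp
      (M := Real.exp (lam * (n * (4 * B ^ 2)))) fun x => ?_
    rw [Real.abs_exp]
    exact Real.exp_le_exp.2 (mul_le_mul_of_nonneg_left ((le_abs_self _).trans (hAb x)) hl)
  rw [Measure.prod_apply hmeas]
  refine (lintegral_mono hsec).trans ?_
  rw [← ofReal_integral_eq_lintegral_ofReal (hint.const_mul _)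
    (Filter.Eventually.of_forall fun _ => by positivity), integral_const_mul]
  refine ENNReal.ofReal_le_ofReal ?_
  refine (mul_le_mul_of_nonneg_left (integral_exp_le_of_bounded_differences μ hAm hAb hAd lam)
    (Real.exp_pos _).le).trans ?_
  rw [← Real.exp_add]
  refine Real.exp_le_exp.2 ?_
  have h1 := mul_le_mul_of_nonneg_left hEA hl
  have h2 : lam ^ 2 * (4 * B ^ 2) ^ 2 / 8 = 2 * lam ^ 2 * B ^ 4 := by ring
  rw [h2]
  linarith

section Networks

variable {d n L : ℕ} {B₀ B₁ : ℝ} {ι : Type*} [Finite ι] [Nonempty ι] {θ₀ : SierNet d}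
  {θ : ι → SierNet d}

theorem two_le_of_mem {θ : SierNet d} (h : θ ∈ sierParams d L B₀ B₁) : 2 ≤ L :=
  (Nat.le_add_left 2 _).trans h.1

theorem nonneg_of_mem_right {θ : SierNet d} (h : θ ∈ sierParams d L B₀ B₁) : 0 ≤ B₁ :=
  θ.totalVariation_nonneg.trans h.2.2

/-- Gaussian complexity of a finite class of networks, centred at one network and shrunk towards
it. -/
theorem integral_maxLinear_eval_le (hd : 1 ≤ d) (h₀ : θ₀ ∈ sierParams d L B₀ B₁)
    (hθ : ∀ i, θ i ∈ sierParams d L B₀ B₁) (v : NNReal) (x : Fin n → Cube d) (t : ι → ℝ)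
    (ht : ∀ i, 0 ≤ t i ∧ t i ≤ 1) :
    ∫ y, maxLinear (fun i k => t i * ((θ i).eval (x k) - θ₀.eval (x k))) y
      ∂(Measure.pi fun _ => gaussianReal 0 v) ≤
      B₁ * Real.sqrt (2 * (L * Real.log 2 + Real.log (2 * d))) * Real.sqrt (n * v) := by
  set Γ : Measure (Fin n → ℝ) := Measure.pi fun _ => gaussianReal 0 v with hΓ
  choose θ' hθ' he using fun i =>
    SierNet.exists_eval_eq_convexCombination h₀ (hθ i) (ht i).1 (ht i).2
  -- Shrinking towards `θ₀` stays in the class by convexity, and centring only subtracts a linear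
  -- functional of mean zero.
  have e : ∀ y, maxLinear (fun i k => t i * ((θ i).eval (x k) - θ₀.eval (x k))) y =
      maxLinear (fun i k => (θ' i).eval (x k)) y - ∑ k, θ₀.eval (x k) * y k := by
    intro y
    rw [maxLinear, maxLinear, sub_eq_add_neg,
      ciSup_add (Finite.bddAbove_range fun i => ∑ k, (θ' i).eval (x k) * y k)]
    refine iSup_congr fun i => ?_
    rw [← sub_eq_add_neg, ← Finset.sum_sub_distrib]
    refine Finset.sum_congr rfl fun k _ => ?_
    rw [he]
    ring
  have hlin : ∀ k : Fin n, Integrable (fun y : Fin n → ℝ => θ₀.eval (x k) * y k) Γ := fun k =>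
    (integrable_comp_eval (μ := fun _ : Fin n => gaussianReal 0 v) (i := k) (f := fun y : ℝ => y)
      ((memLp_id_gaussianReal 1).integrable le_rfl)).const_mul _
  have hzero : ∫ y : Fin n → ℝ, ∑ k, θ₀.eval (x k) * y k ∂Γ = 0 := by
    rw [integral_finsetSum _ fun k _ => hlin k]
    refine Finset.sum_eq_zero fun k _ => ?_
    rw [integral_const_mul, integral_comp_eval (μ := fun _ : Fin n => gaussianReal 0 v) (i := k)
      (f := fun y : ℝ => y) (by fun_prop)]
    simp
  simp only [e]
  rw [integral_sub (integrable_maxLinear v _) (integrable_finsetSum _ fun k _ => hlin k), hzero,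
    sub_zero]
  refine integral_maxLinear_le_of_sum_signs v _
    (mul_nonneg (nonneg_of_mem_right h₀) (Real.sqrt_nonneg _)) fun a => ?_
  refine (sum_signs_iSup_abs_eval_le hd (two_le_of_mem h₀) θ' (fun i => (hθ' i).1)
    (fun i => (hθ' i).2.2) x a).trans (le_of_eq ?_)
  ring

/-- Rademacher complexity of the squared distances of a finite class of networks to one network. -/
theorem sum_signs_iSup_sq_le (hd : 1 ≤ d) (h₀ : θ₀ ∈ sierParams d L B₀ B₁)
    (hθ : ∀ i, θ i ∈ sierParams d L B₀ B₁) (x : Fin n → Cube d) :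
    ∑ r : Fin n → Bool,
      ⨆ i, ∑ k, boolSign (r k) * ((θ i).eval (x k) - θ₀.eval (x k)) ^ 2 ≤
      2 ^ n * (4 * B₀ * B₁ * Real.sqrt n *
        Real.sqrt (2 * (L * Real.log 2 + Real.log (2 * d)))) := by
  obtain ⟨i₀⟩ := ‹Nonempty ι›
  have : Nonempty ι := ⟨i₀⟩
  have hB0 : 0 ≤ B₀ := (abs_nonneg _).trans (h₀.2.1 fun _ => ⟨0, by norm_num⟩)
  -- The square has Lipschitz constant `4 * B₀` here, because `|f + f' - 2 * f₀| ≤ 4 * B₀`.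
  have hc := sum_signs_contraction (Ψ := fun y => y)
    (fun i k => ((θ i).eval (x k) - θ₀.eval (x k)) ^ 2) (fun i k => 4 * B₀ * (θ i).eval (x k))
    (fun k => signDominated_id fun i j => by
      have e : ((θ i).eval (x k) - θ₀.eval (x k)) ^ 2 - ((θ j).eval (x k) - θ₀.eval (x k)) ^ 2 =
          ((θ i).eval (x k) + (θ j).eval (x k) - 2 * θ₀.eval (x k)) *
            ((θ i).eval (x k) - (θ j).eval (x k)) := by ring
      rw [e, abs_mul, ← mul_sub, abs_mul, abs_of_nonneg (by positivity : 0 ≤ 4 * B₀)]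
      refine mul_le_mul_of_nonneg_right ?_ (abs_nonneg _)
      have h1 := abs_le.1 ((hθ i).2.1 (x k))
      have h2 := abs_le.1 ((hθ j).2.1 (x k))
      have h3 := abs_le.1 (h₀.2.1 (x k))
      rw [abs_le]
      constructor <;> linarith) 0
  simp only [Pi.zero_apply, zero_add] at hc
  have h := sum_signs_iSup_abs_eval_le hd (two_le_of_mem h₀) θ (fun i => (hθ i).1)
    (fun i => (hθ i).2.2) x fun _ => 4 * B₀
  have e : Real.sqrt (∑ _k : Fin n, (4 * B₀) ^ 2) = 4 * B₀ * Real.sqrt n := by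
    rw [Finset.sum_const, Finset.card_univ, Fintype.card_fin, nsmul_eq_mul, mul_comm,
      Real.sqrt_mul (sq_nonneg _), Real.sqrt_sq (by positivity)]
  rw [e] at h
  refine hc.trans (le_trans (Finset.sum_le_sum fun r _ => ?_) (h.trans (le_of_eq (by ring))))
  gcongr with i
  · exact Finite.bddAbove_range _
  · exact le_abs_self _

/-- Probability that least squares over a finite class of networks prefers a network far from the
regression function. -/
theorem measure_exists_network_le (ν : Measure (Cube d)) [IsProbabilityMeasure ν] (hd : 1 ≤ d)
    (h₀ : θ₀ ∈ sierParams d L B₀ B₁) (hθ : ∀ i, θ i ∈ sierParams d L B₀ B₁) (σ : NNReal)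
    {κ H lam : ℝ} (hH : 0 ≤ H) (hl : 0 ≤ lam) (hlv : 8 * lam * σ ^ 2 ≤ 1)
    (hκ : ∀ i, κ ≤ ∫ x, ((θ i).eval x - θ₀.eval x) ^ 2 ∂ν) :
    ((Measure.pi fun _ => ν).prod (Measure.pi fun _ => gaussianReal 0 (σ ^ 2)))
      {p : (Fin n → Cube d) × (Fin n → ℝ) |
        ∃ i, ∑ k, ((θ i).eval (p.1 k) - θ₀.eval (p.1 k)) ^ 2 - H <
          ∑ k, ((θ i).eval (p.1 k) - θ₀.eval (p.1 k)) * p.2 k} ≤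
      ENNReal.ofReal (Real.exp (-lam * (n * κ - 2 * H - 2 * (B₁ * (4 * B₀ + σ) * Real.sqrt n *
        Real.sqrt (2 * (L * Real.log 2 + Real.log (2 * d))))) + n * (2 * lam ^ 2 * B₀ ^ 4))) := by
  have hs : Real.sqrt (n * ((σ ^ 2 : NNReal) : ℝ)) = Real.sqrt n * σ := by
    rw [NNReal.coe_pow, Real.sqrt_mul (Nat.cast_nonneg n), Real.sqrt_sq σ.coe_nonneg]
  refine (measure_prod_gaussian_ge_sq_le ν (σ ^ 2)
    (g := fun i x => (θ i).eval x - θ₀.eval x)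
    (fun i => ((θ i).continuous_eval.sub θ₀.continuous_eval).measurable) (B := B₀)
    (M := B₁ * Real.sqrt (2 * (L * Real.log 2 + Real.log (2 * d))) * (Real.sqrt n * σ))
    (fun i x => ?_) ?_ hH hl (by simpa using hlv) hκ (fun x t ht => ?_)
    (fun x => sum_signs_iSup_sq_le hd h₀ hθ x)).trans (le_of_eq ?_)
  · have h1 := abs_le.1 ((hθ i).2.1 x)
    have h2 := abs_le.1 (h₀.2.1 x)
    rw [abs_le]
    constructor <;> linarith
  · have := nonneg_of_mem_right h₀
    positivity
  · rw [← hs]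
    exact integral_maxLinear_eval_le hd h₀ hθ _ x t ht
  · congr 3
    ring

end Networks

/-- Choice of the exponent that balances the sampling error and the noise. -/
theorem exists_exponent_le {B δ s : ℝ} (hB : 0 < B) (hs : 0 < s) (hδ : 0 ≤ δ) (hδB : δ ≤ B ^ 2) :
    ∃ lam, 0 ≤ lam ∧ 8 * lam * s ^ 2 ≤ 1 ∧
      (δ ^ 2 / (2 * B ^ 4) ≤ 2 * lam * δ - 2 * lam ^ 2 * B ^ 4 ∨
        δ ^ 2 / (8 * B ^ 2 * s ^ 2) ≤ 2 * lam * δ - 2 * lam ^ 2 * B ^ 4) := by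
  -- The unconstrained maximizer of `2 * lam * δ - 2 * lam² * B⁴` is `δ / (2 * B⁴)`. If the noise
  -- constraint forbids it, the boundary value is used, and `δ ≤ B²` turns the linear gain `lam * δ`
  -- into a quadratic one.
  by_cases h : 8 * (δ / (2 * B ^ 4)) * s ^ 2 ≤ 1
  · refine ⟨δ / (2 * B ^ 4), by positivity, h, Or.inl (le_of_eq ?_)⟩
    field_simp
    ring
  · refine ⟨1 / (8 * s ^ 2), by positivity, le_of_eq (by field_simp), Or.inr ?_⟩
    rw [not_le] at h
    have h1 : 1 / (8 * s ^ 2) * B ^ 4 ≤ δ / 2 := by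
      have e : 8 * (δ / (2 * B ^ 4)) * s ^ 2 = δ * (8 * s ^ 2) / (2 * B ^ 4) := by ring
      rw [e, lt_div_iff₀ (by positivity)] at h
      rw [one_div, inv_mul_le_iff₀ (by positivity)]
      linarith
    set lam := 1 / (8 * s ^ 2) with hlam
    have hl : 0 < lam := by positivity
    have h2 : δ ^ 2 / (8 * B ^ 2 * s ^ 2) = lam * δ * (δ / B ^ 2) := by
      rw [hlam]
      field_simp
    have h3 : δ / B ^ 2 ≤ 1 := (div_le_one (by positivity)).2 hδB
    have h4 : lam * δ * (δ / B ^ 2) ≤ lam * δ := mul_le_of_le_one_right (by positivity) h3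
    rw [h2]
    nlinarith [mul_le_mul_of_nonneg_left h1 hl.le]

theorem le_of_forall_shrink {q w : ℝ} (hq : 0 ≤ q)
    (h : ∀ t : ℝ, 0 < t → t ≤ 1 → (2 - t) * q ≤ 2 * w) : q ≤ w := by
  by_contra! hlt
  have h1 := h 1 one_pos le_rfl
  have hq0 : 0 < q := by
    rcases hq.eq_or_lt with h0 | h0
    · rw [← h0] at h1 hlt
      linarith
    · exact h0
  -- This `t` satisfies `t * q ≤ q - w`, whence `q + w ≤ (2 - t) * q ≤ 2 * w`, contradicting `w <
  -- q`.
  have h2 := h (min 1 ((q - w) / q)) (lt_min one_pos (div_pos (by linarith) hq0)) (min_le_left _ _)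
  have h3 : min 1 ((q - w) / q) * q ≤ q - w := by
    rw [← div_mul_cancel₀ (q - w) hq0.ne']
    exact mul_le_mul_of_nonneg_right (by rw [div_mul_cancel₀ _ hq0.ne']; exact min_le_right _ _)
      hq
  nlinarith

theorem exists_card_sdiff_eq {α : Type*} [Fintype α] [DecidableEq α] {s t : Finset α} {m : ℕ}
    (h : m ≤ (s \ t).card) : ∃ u : Finset α, t ⊆ u ∧ (s \ u).card = m := by
  obtain ⟨w, hw, rfl⟩ := Finset.exists_subset_card_eq h
  refine ⟨wᶜ, fun x hx => Finset.mem_compl.2 fun hxw => ?_, ?_⟩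
  · exact (Finset.mem_sdiff.1 (hw hxw)).2 hx
  · congr 1
    ext x
    simp only [Finset.mem_sdiff, Finset.mem_compl, not_not]
    exact ⟨fun hx => hx.2, fun hx => ⟨(Finset.mem_sdiff.1 (hw hx)).1, hx⟩⟩

/-! ### Least squares, excess risk and separability. -/

section Regression

variable {d n L m : ℕ} {B₀ B₁ : ℝ}

/-- Basic inequality for least squares over the convex class of network functions. -/
theorem sum_sq_le_of_isMin_empiricalRisk (hn : 0 < n) {θ θ₀ : SierNet d}
    (hθ : θ ∈ sierParams d L B₀ B₁) (h₀ : θ₀ ∈ sierParams d L B₀ B₁) (z : Fin n → Cube d × ℝ)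
    (hmin : ∀ θ' ∈ sierParams d L B₀ B₁, empiricalRisk z θ.eval ≤ empiricalRisk z θ'.eval) :
    ∑ k, (θ.eval (z k).1 - θ₀.eval (z k).1) ^ 2 ≤
      ∑ k, (θ.eval (z k).1 - θ₀.eval (z k).1) * ((z k).2 - θ₀.eval (z k).1) := by
  refine le_of_forall_shrink (Finset.sum_nonneg fun _ _ => sq_nonneg _) fun t ht0 ht1 => ?_
  -- A move of length `t` towards `θ₀` cannot lower the empirical risk. The change is quadratic in
  -- `t`; dividing by `t` and letting `t` tend to zero gives the first-order condition with the
  -- sharp factor.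
  obtain ⟨θ', hθ', he⟩ := SierNet.exists_eval_eq_convexCombination hθ h₀ ht0.le ht1
  have hn' : (0 : ℝ) < 1 / n := by positivity
  have h := le_of_mul_le_mul_left (hmin θ' hθ') hn'
  have e : ∑ k, (θ'.eval (z k).1 - (z k).2) ^ 2 = ∑ k, (θ.eval (z k).1 - (z k).2) ^ 2 -
      t * ((2 - t) * ∑ k, (θ.eval (z k).1 - θ₀.eval (z k).1) ^ 2 - 2 *
        ∑ k, (θ.eval (z k).1 - θ₀.eval (z k).1) * ((z k).2 - θ₀.eval (z k).1)) := by
    simp only [Finset.mul_sum, ← Finset.sum_sub_distrib]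
    refine Finset.sum_congr rfl fun k _ => ?_
    rw [he]
    ring
  rw [e] at h
  have h2 : t * ((2 - t) * ∑ k, (θ.eval (z k).1 - θ₀.eval (z k).1) ^ 2 - 2 *
        ∑ k, (θ.eval (z k).1 - θ₀.eval (z k).1) * ((z k).2 - θ₀.eval (z k).1)) ≤ t * 0 := by
    linarith
  linarith [le_of_mul_le_mul_left h2 ht0]

theorem excessRisk_eq_integral_sq {σ : NNReal} (P : Measure (Cube d × ℝ)) [IsProbabilityMeasure P]
    {θ θ₀ : SierNet d}
    (hnoise : P.map (fun z => z.2 - θ₀.eval z.1) = gaussianReal 0 (σ ^ 2))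
    (hindep : IndepFun (fun z : Cube d × ℝ => z.1) (fun z => z.2 - θ₀.eval z.1) P) :
    excessRisk P θ₀.eval θ.eval = ∫ x, (θ.eval x - θ₀.eval x) ^ 2 ∂(P.map Prod.fst) := by
  have hc : Continuous fun x => θ.eval x - θ₀.eval x := θ.continuous_eval.sub θ₀.continuous_eval
  have hem : Measurable fun z : Cube d × ℝ => z.2 - θ₀.eval z.1 :=
    measurable_snd.sub (θ₀.continuous_eval.measurable.comp measurable_fst)
  have hei : Integrable (fun z : Cube d × ℝ => z.2 - θ₀.eval z.1) P := by
    have h := (memLp_id_gaussianReal (μ := 0) (v := σ ^ 2) 1).integrable le_rfl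
    rw [← hnoise] at h
    exact h.comp_measurable hem
  have he0 : ∫ z, (z.2 - θ₀.eval z.1) ∂P = 0 := by
    rw [← integral_map (φ := fun z : Cube d × ℝ => z.2 - θ₀.eval z.1) (f := fun y => y)
      hem.aemeasurable (by fun_prop), hnoise, integral_id_gaussianReal]
  obtain ⟨M, hM⟩ : ∃ M, ∀ x, |θ.eval x - θ₀.eval x| ≤ M := by
    obtain ⟨M, hM⟩ := (isCompact_range hc).isBounded.exists_norm_le
    exact ⟨M, fun x => hM _ (Set.mem_range_self x)⟩
  have hgm : Measurable fun z : Cube d × ℝ => θ.eval z.1 - θ₀.eval z.1 :=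
    hc.measurable.comp measurable_fst
  have hsq : Integrable (fun z : Cube d × ℝ => (θ.eval z.1 - θ₀.eval z.1) ^ 2) P := by
    refine integrable_of_abs_le P (hgm.pow_const 2) (M := M ^ 2) fun z => ?_
    rw [abs_pow]
    exact pow_le_pow_left₀ (abs_nonneg _) (hM z.1) 2
  have hcross : ∫ z, (θ.eval z.1 - θ₀.eval z.1) * (z.2 - θ₀.eval z.1) ∂P = 0 := by
    have h := (hindep.comp hc.measurable measurable_id).integral_fun_mul_eq_mul_integral
      hgm.aestronglyMeasurable hem.aestronglyMeasurable
    refine h.trans ?_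
    simp only [Function.comp_def, id_eq, he0, mul_zero]
  have hcrossi : Integrable (fun z : Cube d × ℝ =>
      (θ.eval z.1 - θ₀.eval z.1) * (z.2 - θ₀.eval z.1)) P :=
    hei.bdd_mul hgm.aestronglyMeasurable (Filter.Eventually.of_forall fun z => hM z.1)
  have e : ∀ z : Cube d × ℝ, (θ.eval z.1 - z.2) ^ 2 - (θ₀.eval z.1 - z.2) ^ 2 =
      (θ.eval z.1 - θ₀.eval z.1) ^ 2 -
        2 * ((θ.eval z.1 - θ₀.eval z.1) * (z.2 - θ₀.eval z.1)) := fun z => by ring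
  rw [excessRisk]
  simp only [e]
  rw [integral_sub hsq (hcrossi.const_mul 2), integral_const_mul, hcross, mul_zero, sub_zero]
  exact (integral_map (f := fun x => (θ.eval x - θ₀.eval x) ^ 2) measurable_fst.aemeasurable
    (hc.measurable.pow_const 2).aestronglyMeasurable).symm

/-- The predictive value requires exactly `m` omitted variables, so the support is enlarged by
surplus omitted ones; functions with smaller support remain admissible. -/
theorem predictiveValue_le {F : Set (Cube d → ℝ)} (P : Measure (Cube d × ℝ)) {μ f : Cube d → ℝ}
    (hf : f ∈ F) (hm : m ≤ (coordSupport μ \ coordSupport f).card) :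
    predictiveValue F P μ m ≤ ((excessRisk P μ f : ℝ) : EReal) := by
  obtain ⟨s, hs, hcard⟩ := exists_card_sdiff_eq hm
  exact iInf₂_le_of_le s hcard (iInf₂_le f ⟨hf, hs⟩)

theorem coordSupport_zeroNet : coordSupport (SierNet.zeroNet d).eval = ∅ := by
  refine Finset.subset_empty.1 (coordSupport_subset fun x y _ => ?_)
  rw [SierNet.zeroNet_eval, SierNet.zeroNet_eval]

theorem integral_sq_zeroNet_le (ν : Measure (Cube d)) [IsProbabilityMeasure ν] {θ₀ : SierNet d}
    (h₀ : ∀ x, |θ₀.eval x| ≤ B₀) :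
    ∫ x, ((SierNet.zeroNet d).eval x - θ₀.eval x) ^ 2 ∂ν ≤ B₀ ^ 2 := by
  have h := norm_integral_le_of_norm_le_const (μ := ν) (C := B₀ ^ 2)
    (f := fun x => ((SierNet.zeroNet d).eval x - θ₀.eval x) ^ 2)
    (Filter.Eventually.of_forall fun x => by
      rw [SierNet.zeroNet_eval, zero_sub, neg_sq, norm_pow]
      exact pow_le_pow_left₀ (abs_nonneg _) (h₀ x) 2)
  exact (le_abs_self _).trans (by simpa using h)

/-- Joint law of the design points and the noise variables of a sample. -/
theorem measurePreserving_design_noise {σ : NNReal} (P : Measure (Cube d × ℝ))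
    [IsProbabilityMeasure P] {θ₀ : SierNet d}
    (hnoise : P.map (fun z => z.2 - θ₀.eval z.1) = gaussianReal 0 (σ ^ 2))
    (hindep : IndepFun (fun z : Cube d × ℝ => z.1) (fun z => z.2 - θ₀.eval z.1) P)
    {Ω : Type*} [MeasurableSpace Ω] (ρ : Measure Ω) [IsProbabilityMeasure ρ]
    (Z : Fin n → Ω → Cube d × ℝ) (hZmeas : ∀ i, Measurable (Z i))
    (hZlaw : ∀ i, ρ.map (Z i) = P) (hZindep : iIndepFun Z ρ) :
    MeasurePreserving
      (fun ω => ((fun i => (Z i ω).1), fun i => (Z i ω).2 - θ₀.eval (Z i ω).1)) ρ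
      ((Measure.pi fun _ => P.map Prod.fst).prod
        (Measure.pi fun _ => gaussianReal 0 (σ ^ 2))) := by
  have hprob : IsProbabilityMeasure (P.map Prod.fst) :=
    Measure.isProbabilityMeasure_map measurable_fst.aemeasurable
  have hem : Measurable fun z : Cube d × ℝ => z.2 - θ₀.eval z.1 :=
    measurable_snd.sub (θ₀.continuous_eval.measurable.comp measurable_fst)
  have hT : Measurable fun z : Cube d × ℝ => (z.1, z.2 - θ₀.eval z.1) := measurable_fst.prodMk hem
  have hPT : P.map (fun z : Cube d × ℝ => (z.1, z.2 - θ₀.eval z.1)) =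
      (P.map Prod.fst).prod (gaussianReal 0 (σ ^ 2)) := by
    rw [← hnoise]
    exact (indepFun_iff_map_prod_eq_prod_map_map measurable_fst.aemeasurable
      hem.aemeasurable).1 hindep
  have hW := hZindep.comp (fun _ z => (z.1, z.2 - θ₀.eval z.1)) fun _ => hT
  have hWm : ∀ i, Measurable ((fun z : Cube d × ℝ => (z.1, z.2 - θ₀.eval z.1)) ∘ Z i) :=
    fun i => hT.comp (hZmeas i)
  have h1 := (iIndepFun_iff_map_fun_eq_pi_map fun i => (hWm i).aemeasurable).1 hW
  have h2 : ∀ i, ρ.map ((fun z : Cube d × ℝ => (z.1, z.2 - θ₀.eval z.1)) ∘ Z i) =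
      (P.map Prod.fst).prod (gaussianReal 0 (σ ^ 2)) := fun i => by
    rw [← Measure.map_map hT (hZmeas i), hZlaw, hPT]
  simp only [h2] at h1
  exact (measurePreserving_arrowProdEquivProdArrow (Cube d) ℝ (Fin n) (fun _ => P.map Prod.fst)
    fun _ => gaussianReal 0 (σ ^ 2)).comp ⟨measurable_pi_iff.2 hWm, h1⟩

theorem continuous_integral_continuousMap (ν : Measure (Cube d)) [IsProbabilityMeasure ν] :
    Continuous fun f : C(Cube d, ℝ) => ∫ x, f x ∂ν := by
  have hi : ∀ f : C(Cube d, ℝ), Integrable f ν := fun f =>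
    integrable_of_abs_le ν f.continuous.measurable (M := ‖f‖) f.norm_coe_le_norm
  refine LipschitzWith.continuous (K := 1) (LipschitzWith.of_dist_le_mul fun f g => ?_)
  rw [Real.dist_eq, ← integral_sub (hi f) (hi g), NNReal.coe_one, one_mul]
  have h := norm_integral_le_of_norm_le_const (μ := ν) (f := fun x => f x - g x) (C := dist f g)
    (Filter.Eventually.of_forall fun x => by
      rw [← dist_eq_norm]; exact ContinuousMap.dist_apply_le_dist x)
  simpa using h

/-- A sequence of networks that is dense for all the functionals that least squares depends on. -/
theorem exists_dense_network_seq (ν : Measure (Cube d)) [IsProbabilityMeasure ν] {θ₀ : SierNet d}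
    (h₀ : θ₀ ∈ sierParams d L B₀ B₁) :
    ∃ u : ℕ → SierNet d, (∀ k, u k ∈ sierParams d L B₀ B₁) ∧
      ∀ θ ∈ sierParams d L B₀ B₁, ∀ (x : Fin n → Cube d) (y : Fin n → ℝ) (κ H : ℝ),
        κ < ∫ x, (θ.eval x - θ₀.eval x) ^ 2 ∂ν →
        ∑ k, (θ.eval (x k) - θ₀.eval (x k)) ^ 2 - H <
          ∑ k, (θ.eval (x k) - θ₀.eval (x k)) * y k →
        ∃ j, κ < ∫ x, ((u j).eval x - θ₀.eval x) ^ 2 ∂ν ∧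
          ∑ k, ((u j).eval (x k) - θ₀.eval (x k)) ^ 2 - H <
            ∑ k, ((u j).eval (x k) - θ₀.eval (x k)) * y k := by
  let e : SierNet d → C(Cube d, ℝ) := fun θ => ⟨θ.eval, θ.continuous_eval⟩
  obtain ⟨c, hcs, hcc, hcd⟩ := (TopologicalSpace.IsSeparable.of_separableSpace
    (e '' sierParams d L B₀ B₁)).exists_countable_dense_subset
  have hne : c.Nonempty := by
    have : (closure c).Nonempty := ⟨e θ₀, hcd (Set.mem_image_of_mem e h₀)⟩
    exact closure_nonempty_iff.1 this
  obtain ⟨w, rfl⟩ := hcc.exists_eq_range hne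
  choose u hu huw using fun k => hcs (Set.mem_range_self k)
  refine ⟨u, hu, fun θ hθ x y κ H h1 h2 => ?_⟩
  have hev : ∀ a : Cube d, Continuous fun f : C(Cube d, ℝ) => f a := fun a => by fun_prop
  have hopen : IsOpen {f : C(Cube d, ℝ) | κ < ∫ a, (f a - θ₀.eval a) ^ 2 ∂ν ∧
      ∑ k, (f (x k) - θ₀.eval (x k)) ^ 2 - H < ∑ k, (f (x k) - θ₀.eval (x k)) * y k} := by
    have hlt : Continuous fun f : C(Cube d, ℝ) => ∑ k, (f (x k) - θ₀.eval (x k)) ^ 2 - H := by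
      fun_prop
    have hrt : Continuous fun f : C(Cube d, ℝ) => ∑ k, (f (x k) - θ₀.eval (x k)) * y k := by
      fun_prop
    have hint : Continuous fun f : C(Cube d, ℝ) => ∫ a, (f a - θ₀.eval a) ^ 2 ∂ν :=
      (continuous_integral_continuousMap ν).comp
        (by fun_prop : Continuous fun f : C(Cube d, ℝ) => (f - e θ₀) ^ 2)
    exact (isOpen_lt continuous_const hint).and (isOpen_lt hlt hrt)
  obtain ⟨f, hf, j, rfl⟩ := mem_closure_iff.1 (hcd (Set.mem_image_of_mem e hθ)) _ hopen ⟨h1, h2⟩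
  rw [← huw j] at hf
  exact ⟨j, hf⟩

end Regression

/-! ### Assembly of the recovery bound. -/

theorem theorem1
    {d n L m : ℕ} {B₀ B₁ δ : ℝ} {σ : NNReal} (hσ : 0 < σ)
    (hm : 1 ≤ m) (hmd : m ≤ d) (hδ : 0 ≤ δ)
    -- the data distribution; the regression function is the network `θstar`, the noise is Gaussian
    (P : Measure (Cube d × ℝ)) [IsProbabilityMeasure P]
    (θstar : SierNet d) (hθstar : θstar ∈ sierParams d L B₀ B₁)
    (hnoise : P.map (fun z => z.2 - θstar.eval z.1) = gaussianReal 0 (σ ^ 2))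
    (hindep : IndepFun (fun z : Cube d × ℝ => z.1) (fun z => z.2 - θstar.eval z.1) P)
    -- the class of candidate functions in the definition of the predictive value
    (F : Set (Cube d → ℝ)) (hF : ∀ f ∈ F, MemLp (fun z : Cube d × ℝ => f z.1) 2 P)
    (hnet : ∀ θ ∈ sierParams d L B₀ B₁, θ.eval ∈ F)
    -- the sample
    {Ω : Type*} [MeasurableSpace Ω] (ρ : Measure Ω) [IsProbabilityMeasure ρ]
    (Z : Fin n → Ω → Cube d × ℝ) (hZmeas : ∀ i, Measurable (Z i))
    (hZlaw : ∀ i, ρ.map (Z i) = P) (hZindep : iIndepFun Z ρ)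
    -- the global empirical risk minimizer
    (θhat : Ω → SierNet d)
    (hmem : ∀ᵐ ω ∂ρ, θhat ω ∈ sierParams d L B₀ B₁)
    (hmin : ∀ᵐ ω ∂ρ, ∀ θ ∈ sierParams d L B₀ B₁,
      empiricalRisk (fun i => Z i ω) (θhat ω).eval ≤ empiricalRisk (fun i => Z i ω) θ.eval) :
    ρ.real {ω | m ≤ (coordSupport θstar.eval \ coordSupport (θhat ω).eval).card} ≤
      (if predictiveValue F P θstar.eval m ≤
          ((B₁ * (4 * B₀ + σ) * L * Real.sqrt (2 * (L * Real.log 2 + Real.log (2 * d)) / n)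
            + 2 * δ : ℝ) : EReal)
        then (1 : ℝ) else 0)
      + Real.exp (-(n * δ ^ 2 / (2 * B₀ ^ 4)))
      + 2 * Real.exp (-(n * δ ^ 2 / (8 * B₀ ^ 2 * (σ : ℝ) ^ 2))) := by
  classical
  set rad : ℝ := B₁ * (4 * B₀ + σ) * L * Real.sqrt (2 * (L * Real.log 2 + Real.log (2 * d)) / n)
    with hrad
  have hE1 := Real.exp_pos (-(n * δ ^ 2 / (2 * B₀ ^ 4)))
  have hE2 := Real.exp_pos (-(n * δ ^ 2 / (8 * B₀ ^ 2 * (σ : ℝ) ^ 2)))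
  split_ifs with hpv
  · linarith [measureReal_le_one (μ := ρ) (s := {ω | m ≤
      (coordSupport θstar.eval \ coordSupport (θhat ω).eval).card})]
  rw [not_le] at hpv
  rw [zero_add]
  by_cases hcard : (coordSupport θstar.eval).card < m
  · have hempty : {ω | m ≤ (coordSupport θstar.eval \ coordSupport (θhat ω).eval).card} = ∅ :=
      Set.eq_empty_of_forall_notMem fun ω hω => by
        have h1 : m ≤ (coordSupport θstar.eval \ coordSupport (θhat ω).eval).card := hω
        have h2 := Finset.card_le_card
          (Finset.sdiff_subset (s := coordSupport θstar.eval) (t := coordSupport (θhat ω).eval))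
        omega
    rw [hempty, measureReal_empty]
    positivity
  rw [not_lt] at hcard
  -- Covers `n = 0`, and also `B₀ = 0`, where division by zero makes the first exponential equal to
  -- one.
  have htriv : Real.exp (-(n * δ ^ 2 / (2 * B₀ ^ 4))) = 1 →
      ρ.real {ω | m ≤ (coordSupport θstar.eval \ coordSupport (θhat ω).eval).card} ≤
        Real.exp (-(n * δ ^ 2 / (2 * B₀ ^ 4))) +
          2 * Real.exp (-(n * δ ^ 2 / (8 * B₀ ^ 2 * (σ : ℝ) ^ 2))) := fun h => by
    rw [h]
    linarith [measureReal_le_one (μ := ρ) (s := {ω | m ≤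
      (coordSupport θstar.eval \ coordSupport (θhat ω).eval).card})]
  rcases Nat.eq_zero_or_pos n with hn | hn
  · exact htriv (by simp [hn])
  have hB00 : 0 ≤ B₀ := (abs_nonneg _).trans (hθstar.2.1 fun _ => ⟨0, by norm_num⟩)
  rcases hB00.eq_or_lt with hB0 | hB0
  · exact htriv (by simp [← hB0])
  have hd : 1 ≤ d := hm.trans hmd
  have hL : (2 : ℝ) ≤ L := by exact_mod_cast two_le_of_mem hθstar
  have hB1 : 0 ≤ B₁ := nonneg_of_mem_right hθstar
  have hσ' : (0 : ℝ) < σ := hσ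
  have hn' : (0 : ℝ) < n := by exact_mod_cast hn
  have hrad0 : 0 ≤ rad := by positivity
  have hprob : IsProbabilityMeasure (P.map Prod.fst) :=
    Measure.isProbabilityMeasure_map measurable_fst.aemeasurable
  have hzero := SierNet.zeroNet_mem (d := d) (two_le_of_mem hθstar) hB00 hB1
  -- The zero network omits everything at excess risk at most `B₀²`. This caps `κ`, and hence `δ`,
  -- as the choice of the exponent requires.
  have hpvB : predictiveValue F P θstar.eval m ≤ ((B₀ ^ 2 : ℝ) : EReal) := by
    refine (predictiveValue_le P (hnet _ hzero) ?_).trans (EReal.coe_le_coe_iff.2 ?_)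
    · rwa [coordSupport_zeroNet, Finset.sdiff_empty]
    · rw [excessRisk_eq_integral_sq P hnoise hindep]
      exact integral_sq_zeroNet_le _ hθstar.2.1
  obtain ⟨κ, hκ1, hκ2⟩ := EReal.lt_iff_exists_real_btwn.1 hpv
  have hκ1 := EReal.coe_lt_coe_iff.1 hκ1
  have hκB : κ < B₀ ^ 2 := EReal.coe_lt_coe_iff.1 (hκ2.trans_le hpvB)
  obtain ⟨lam, hl0, hlσ, hlam⟩ := exists_exponent_le hB0 hσ' hδ (by linarith)
  -- Half of the gap above `rad + 2 * δ` is spent as slack: it makes the basic inequality strict,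
  -- hence stable under approximation, and leaves `n * κ - 2 * H = n * (rad + 2 * δ)`.
  set H : ℝ := n * ((κ - (rad + 2 * δ)) / 2) with hH
  have hH0 : 0 < H := mul_pos hn' (by linarith)
  obtain ⟨u, hu, hdense⟩ := exists_dense_network_seq (n := n) (P.map Prod.fst) hθstar
  have hΦ := measurePreserving_design_noise P hnoise hindep ρ Z hZmeas hZlaw hZindep
  set Φ : Ω → (Fin n → Cube d) × (Fin n → ℝ) := fun ω =>
    ((fun i => (Z i ω).1), fun i => (Z i ω).2 - θstar.eval (Z i ω).1) with hΦdef
  set Q := ((Measure.pi fun _ : Fin n => P.map Prod.fst).prod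
    (Measure.pi fun _ : Fin n => gaussianReal 0 (σ ^ 2))) with hQ
  -- The bad event for the distant networks among the first `N` of the dense sequence. The bound
  -- does not depend on `N`, so it passes to the increasing union.
  let U : ℕ → Set ((Fin n → Cube d) × (Fin n → ℝ)) := fun N =>
    {p | ∃ j : {j : Fin N // κ < ∫ x, ((u j).eval x - θstar.eval x) ^ 2 ∂(P.map Prod.fst)},
      ∑ k, ((u j).eval (p.1 k) - θstar.eval (p.1 k)) ^ 2 - H <
        ∑ k, ((u j).eval (p.1 k) - θstar.eval (p.1 k)) * p.2 k}
  have hUmono : Monotone U := by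
    rintro N N' hN p ⟨⟨j, hj⟩, hp⟩
    exact ⟨⟨⟨j, j.2.trans_le hN⟩, hj⟩, hp⟩
  set bound : ℝ := Real.exp (-lam * (n * κ - 2 * H - 2 * (B₁ * (4 * B₀ + σ) * Real.sqrt n *
    Real.sqrt (2 * (L * Real.log 2 + Real.log (2 * d))))) + n * (2 * lam ^ 2 * B₀ ^ 4)) with hbound
  have hU : ∀ N, Q (U N) ≤ ENNReal.ofReal bound := by
    intro N
    rcases isEmpty_or_nonempty
      {j : Fin N // κ < ∫ x, ((u j).eval x - θstar.eval x) ^ 2 ∂(P.map Prod.fst)} with hN | hN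
    · have : U N = ∅ := Set.eq_empty_of_forall_notMem fun p hp => hN.false hp.choose
      rw [this, measure_empty]
      exact zero_le
    · exact measure_exists_network_le (P.map Prod.fst) (n := n) (H := H) (lam := lam) (κ := κ)
        (θ := fun j : {j : Fin N // κ < ∫ x, ((u j).eval x - θstar.eval x) ^ 2 ∂(P.map Prod.fst)} =>
          u j) hd hθstar (fun j => hu _) σ hH0.le hl0 hlσ fun j => j.2.le
  have hUm : ∀ N, MeasurableSet (U N) := by
    intro N
    simp only [U, Set.ofPred_exists]
    have hc : ∀ θ : SierNet d, Measurable fun x => θ.eval x - θstar.eval x := fun θ =>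
      (θ.continuous_eval.sub θstar.continuous_eval).measurable
    refine MeasurableSet.iUnion fun j => measurableSet_lt ?_ ?_
    · exact (Finset.measurable_sum _ fun k _ => ((hc _).comp
        ((measurable_pi_apply k).comp measurable_fst)).pow_const 2).sub_const H
    · exact Finset.measurable_sum _ fun k _ => ((hc _).comp
        ((measurable_pi_apply k).comp measurable_fst)).mul
        ((measurable_pi_apply k).comp measurable_snd)
  have hincl : ∀ᵐ ω ∂ρ,
      ω ∈ {ω | m ≤ (coordSupport θstar.eval \ coordSupport (θhat ω).eval).card} →
      ω ∈ Φ ⁻¹' ⋃ N, U N := by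
    filter_upwards [hmem, hmin] with ω h1 h2 hω
    have hrisk := hκ2.trans_le (predictiveValue_le P (hnet _ h1) hω)
    rw [excessRisk_eq_integral_sq P hnoise hindep] at hrisk
    have hls := sum_sq_le_of_isMin_empiricalRisk hn h1 hθstar _ h2
    obtain ⟨j, hj1, hj2⟩ := hdense _ h1 (Φ ω).1 (Φ ω).2 κ H (EReal.coe_lt_coe_iff.1 hrisk)
      (by linarith)
    exact Set.mem_iUnion.2 ⟨j + 1, ⟨⟨j, j.lt_succ_self⟩, hj1⟩, hj2⟩
  have hmeasure : ρ {ω | m ≤ (coordSupport θstar.eval \ coordSupport (θhat ω).eval).card} ≤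
      ENNReal.ofReal bound := by
    -- The omission event need not be measurable; it is almost surely contained in a measurable one.
    refine (measure_mono_ae (t := Φ ⁻¹' ⋃ N, U N) hincl).trans ?_
    rw [hΦ.measure_preimage (MeasurableSet.iUnion hUm).nullMeasurableSet, hUmono.measure_iUnion]
    exact iSup_le hU
  have hreal : ρ.real {ω | m ≤ (coordSupport θstar.eval \ coordSupport (θhat ω).eval).card} ≤
      bound := ENNReal.toReal_le_of_le_ofReal (Real.exp_pos _).le hmeasure
  -- The factor `L` of the stated rate enters here only through `L ≥ 2`, to absorb the factor 2 of
  -- the complexity term.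
  have hsqrt : 2 * (B₁ * (4 * B₀ + σ) * Real.sqrt n *
      Real.sqrt (2 * (L * Real.log 2 + Real.log (2 * d)))) ≤ n * rad := by
    have e : n * rad = L * (B₁ * (4 * B₀ + σ) * Real.sqrt n *
        Real.sqrt (2 * (L * Real.log 2 + Real.log (2 * d)))) := by
      rw [hrad, Real.sqrt_div' _ hn'.le]
      have h3 : Real.sqrt n ≠ 0 := (Real.sqrt_pos.2 hn').ne'
      field_simp
      rw [Real.sq_sqrt hn'.le]
      ring
    rw [e]
    exact mul_le_mul_of_nonneg_right hL (by positivity)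
  have hexp : bound ≤ Real.exp (-(n * (2 * lam * δ - 2 * lam ^ 2 * B₀ ^ 4))) := by
    refine Real.exp_le_exp.2 ?_
    have h5 := mul_le_mul_of_nonneg_left hsqrt hl0
    have h6 : lam * (n * κ - 2 * H) = lam * (n * rad) + lam * (n * (2 * δ)) := by
      rw [hH]
      ring
    linarith
  refine hreal.trans (hexp.trans ?_)
  rcases hlam with h | h
  · have h7 : Real.exp (-(n * (2 * lam * δ - 2 * lam ^ 2 * B₀ ^ 4))) ≤
        Real.exp (-(n * δ ^ 2 / (2 * B₀ ^ 4))) := by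
      rw [mul_div_assoc]
      gcongr
    linarith
  · have h7 : Real.exp (-(n * (2 * lam * δ - 2 * lam ^ 2 * B₀ ^ 4))) ≤
        Real.exp (-(n * δ ^ 2 / (8 * B₀ ^ 2 * (σ : ℝ) ^ 2))) := by
      rw [mul_div_assoc]
      gcongr
    linarith
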